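/- Let $I=[0,1]$, $X_0=I^2\setminus\{(0,0)\}$, $X=I^2\setminus\{(0,0),(1,1)\}$, and let $F$ be the minimal model map $$F(x,y)=\left(\frac{y(1-x)}{x+y-xy},\ \frac{x(1-y)}{x+y-xy}\right)\quad\text{on }X_0 ,$$ with fixed point $p_*=(x_*,x_*)$, $x_*=\frac{3-\sqrt5}{2}$. Let $(s,t)$ be the orthonormal coordinates with origin $p_*$ given by $s=\frac{x-y}{\sqrt2}$, $t=\frac{x+y-2x_*}{\sqrt2}$. For $\delta>0$ let $\psi_\delta:\mathbb R\to\mathbb R$ be the odd continuous piecewise linear function with $$\psi_\delta(t)=\begin{cases}-2t,&0\le t\le\delta\\ 2(t-2\delta),&\delta\le t\le3\delta\\ 5\delta-t,&t\ge3\delta\end{cases}$$ let $R_\delta(s,t)=(-2s,\psi_\delta(t))$ in $(s,t)$-coordinates, and let $\sigma_\delta(r)=0$ for $r\le5\sqrt2\,\delta$, $\sigma_\delta(r)=\frac{r-5\sqrt2\,\delta}{\sqrt2\,\delta}$ for $5\sqrt2\,\delta\le r\le6\sqrt2\,\delta$, and $\sigma_\delta(r)=1$ for $r\ge6\sqrt2\,\delta$.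 For $\eta>0$, an $\eta$-smoothing of a piecewise linear function $g$ is a $C^\infty$ function $h$ with $|h-g|<\eta$ everywhere and $h(u)=g(u)$ at every $u$ at distance at least $\eta$ from the corners of $g$ (the corners are $\pm\delta,\pm3\delta$ for $\psi_\delta$ and $5\sqrt2\,\delta,6\sqrt2\,\delta$ for $\sigma_\delta$). **Theorem.** For every $\epsilon>0$ there is $\delta$ with $0<\delta\le0.04$ such that for every $\eta>0$ there are an odd $\eta$-smoothing $\psi$ of $\psi_\delta$ and an $\eta$-smoothing $\sigma$ of $\sigma_\delta$ with values in $[0,1]$ for which the map $$F_\delta(p)=(1-\sigma(r))\,R(p)+\sigma(r)\,F(p),\qquad r=\|p-p_*\|,\quad R(s,t)=(-2s,\psi(t)),$$ has the following properties. 1. $F_\delta$ is $C^\infty$ on $X_0$, maps $X$ into $X$, and $\|F_\delta(p)-F(p)\|<\epsilon$ for all $p\in X_0$. 2. $p_*$ is a snap-back repeller of $F_\delta$ on $X$: $F_\delta(p_*)=p_*$, and there is a closed ball $B\subset X$ of positive radius centred at $p_*$ such that $F_\delta$ is differentiable on $B$ with all eigenvalues of $DF_\delta(x)$ of modulus greater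 than $1$ for every $x\in B$, and $B$ contains a snap-back point. Here a snap-back point is a point $q\ne p_*$ such that $F_\delta^m(q)=p_*$ and $\det D(F_\delta^m)(q)\ne0$ for some $m\ge1$. 3. The four points $(s,t)=(0,\pm2\delta)$ and $(s,t)=(0,\pm5\delta)$ are snap-back points in this sense. 4. $F_\delta$ is chaotic on $X$ in the sense of Marotto: there is $N\ge1$ such that for every $n\ge N$ there is a point of $X$ of least period $n$; and there is an uncountable set $S\subset X$ without periodic points such that $F_\delta(S)\subset S$, $\limsup_{k}\|F_\delta^k(x)-F_\delta^k(y)\|>0$ for all distinct $x,y\in S$ and also for all $x\in S$ and all periodic points $y\in X$, and there is an uncountable $S_0\subset S$ with $\liminf_k\|F_\delta^k(x)-F_\delta^k(y)\|=0$ for all $x,y\in S_0$. -/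

import Mathlib

open Set Filter Function
open scoped ContDiff

noncomputable section

namespace RSFlipFlop

/-- The Euclidean plane. -/
abbrev Plane : Type := EuclideanSpace ℝ (Fin 2)

/-- The closed unit square. -/
def unitSquare : Set Plane := {p | p 0 ∈ Icc (0 : ℝ) 1 ∧ p 1 ∈ Icc (0 : ℝ) 1}

/-- The unit square without the origin: the set on which the minimal model map is defined. -/
def mapDomain : Set Plane := unitSquare \ {!₂[(0 : ℝ), 0]}

/-- The phase space `X`: the unit square without `(0,0)` and `(1,1)`. All forward iterates of the
minimal model map are defined on it. -/
def phaseSpace : Set Plane := unitSquare \ {!₂[(0 : ℝ), 0], !₂[(1 : ℝ), 1]}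

/-- The minimal model map `F = (ξ, η)` of the RS flip-flop circuit. -/
def minimalMap (p : Plane) : Plane :=
  !₂[p 1 * (1 - p 0) / (p 0 + p 1 - p 0 * p 1), p 0 * (1 - p 1) / (p 0 + p 1 - p 0 * p 1)]

/-- The common coordinate `x_* = (3 - √5)/2` of the fixed point. -/
def xStar : ℝ := (3 - Real.sqrt 5) / 2

/-- The fixed point `p_*` of the minimal model map in `X`. -/
def pStar : Plane := !₂[xStar, xStar]

/-- The point with `(s,t)`-coordinates `(s,t)`: orthonormal coordinates with origin `p_*`, the
`s`-axis pointing to the right along the linear unstable manifold `x + y = 2 x_*`, and the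
`t`-axis pointing upward along the stable manifold `y = x`. -/
def ofST (s t : ℝ) : Plane :=
  !₂[xStar + (s + t) / Real.sqrt 2, xStar + (t - s) / Real.sqrt 2]

/-- The `s`-coordinate of a point. -/
def sCoord (p : Plane) : ℝ := (p 0 - p 1) / Real.sqrt 2

/-- The `t`-coordinate of a point. -/
def tCoord (p : Plane) : ℝ := (p 0 + p 1 - 2 * xStar) / Real.sqrt 2

theorem ofST_coords (p : Plane) : ofST (sCoord p) (tCoord p) = p := by
  have h2 : Real.sqrt 2 * Real.sqrt 2 = 2 := Real.mul_self_sqrt (by norm_num)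
  have h0 : Real.sqrt 2 ≠ 0 := by positivity
  have h2' : Real.sqrt 2 ^ 2 = 2 := by rw [pow_two, h2]
  ext i
  fin_cases i
  · simp only [ofST, sCoord, tCoord]
    simp
    field_simp
    rw [h2']
    ring
  · simp only [ofST, sCoord, tCoord]
    simp
    field_simp
    rw [h2']
    ring

/-- The odd linear function `φ_δ(s) = -2 s` (it does not depend on `δ`). -/
def phi (s : ℝ) : ℝ := -2 * s

/-- The piecewise linear function `ψ_δ` for nonnegative arguments. -/
def psiPos (δ t : ℝ) : ℝ :=
  if t ≤ δ then -2 * t else if t ≤ 3 * δ then 2 * (t - 2 * δ) else 5 * δ - t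

/-- The odd piecewise linear function `ψ_δ`, with corners at `±δ` and `±3δ`. -/
def psi (δ t : ℝ) : ℝ := if 0 ≤ t then psiPos δ t else -psiPos δ (-t)

/-- The piecewise linear cut-off `σ`, with corners at `5√2 δ` and `6√2 δ`. -/
def sigma (δ r : ℝ) : ℝ :=
  if r ≤ 5 * δ * Real.sqrt 2 then 0
  else if r ≤ 6 * δ * Real.sqrt 2 then (1 / (δ * Real.sqrt 2)) * (r - 5 * δ * Real.sqrt 2)
  else 1

/-- The map `(s,t) ↦ (φ(s), ψ(t))` in `(s,t)`-coordinates. With `ψ = psi δ` it is `R_δ`. -/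
def snapMap (ψ : ℝ → ℝ) (p : Plane) : Plane := ofST (phi (sCoord p)) (ψ (tCoord p))

/-- The interpolation `(1 - σ(r)) R(p) + σ(r) F(p)` with `r = ‖p - p_*‖`, where `R` is
`(s,t) ↦ (φ(s), ψ(t))`. -/
def perturbedMap (σ ψ : ℝ → ℝ) (p : Plane) : Plane :=
  (1 - σ ‖p - pStar‖) • snapMap ψ p + σ ‖p - pStar‖ • minimalMap p

/-- `h` is a `C^∞` function obtained from `g` by rounding off the corners of `g` at the points of
`C` at scale `η`: it is uniformly `η`-close to `g`, and it is equal to `g` at distance at least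
`η` from `C`. -/
def IsCornerSmoothing (η : ℝ) (C : Set ℝ) (g h : ℝ → ℝ) : Prop :=
  ContDiff ℝ ∞ h ∧ (∀ u, |h u - g u| < η) ∧ ∀ u, (∀ c ∈ C, η ≤ |u - c|) → h u = g u

/-- `z` is an expanding fixed point of `f` in the closed ball of radius `r`: `f` is differentiable
in the ball, and at each of its points all (complex) eigenvalues of the derivative exceed `1` in
modulus. -/
def IsExpandingFixedPt (f : Plane → Plane) (z : Plane) (r : ℝ) : Prop :=
  f z = z ∧ ∀ x ∈ Metric.closedBall z r, DifferentiableAt ℝ f x ∧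
    ∀ μ : ℂ, (((fderiv ℝ f x).toLinearMap.charpoly).map (algebraMap ℝ ℂ)).IsRoot μ → 1 < ‖μ‖

/-- `q` is a snap-back point of `f` for `z`: a point other than `z` that some iterate of `f` takes
to `z` with nonvanishing Jacobian determinant. -/
def IsSnapBackPoint (f : Plane → Plane) (z q : Plane) : Prop :=
  q ≠ z ∧ ∃ m : ℕ, 0 < m ∧ f^[m] q = z ∧ (fderiv ℝ (f^[m]) q).det ≠ 0

/-- `z` is a snap-back repeller of the map `f` on `D` in the sense of Marotto: it is an expanding
fixed point in a closed ball contained in `D`, and this ball contains a snap-back point. -/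
def IsSnapBackRepeller (f : Plane → Plane) (D : Set Plane) (z : Plane) : Prop :=
  ∃ r : ℝ, 0 < r ∧ Metric.closedBall z r ⊆ D ∧ IsExpandingFixedPt f z r ∧
    ∃ q ∈ Metric.closedBall z r, IsSnapBackPoint f z q

/-- Chaos of the map `f` on `D` in the sense of Marotto: there are points of every large enough
least period, and there is an uncountable forward invariant scrambled set `S` without periodic
points, with an uncountable subset `S₀` any two points of which are proximal. -/
def IsMarottoChaotic (f : Plane → Plane) (D : Set Plane) : Prop :=
  (∃ N : ℕ, 0 < N ∧ ∀ n : ℕ, N ≤ n → ∃ x ∈ D, minimalPeriod f x = n) ∧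
  ∃ S : Set Plane, S ⊆ D ∧ ¬ S.Countable ∧ (∀ x ∈ S, x ∉ periodicPts f) ∧
    MapsTo f S S ∧
    (∀ x ∈ S, ∀ y ∈ S, x ≠ y → 0 < limsup (fun k : ℕ => edist (f^[k] x) (f^[k] y)) atTop) ∧
    (∀ x ∈ S, ∀ y ∈ D, y ∈ periodicPts f →
      0 < limsup (fun k : ℕ => edist (f^[k] x) (f^[k] y)) atTop) ∧
    ∃ S₀ : Set Plane, S₀ ⊆ S ∧ ¬ S₀.Countable ∧
      ∀ x ∈ S₀, ∀ y ∈ S₀, liminf (fun k : ℕ => edist (f^[k] x) (f^[k] y)) atTop = 0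

end RSFlipFlop

end

/-! The perturbed map is the explicit product map `snapMap` near `pStar`, and all the required
dynamics lives on the `t`-axis `ofST 0 t`, within distance `5 * δ` of `pStar`. There the cut-off
vanishes and the map is just `t ↦ smoothPsi δ c t`. No general theorem that a snap-back repeller
implies chaos is used: periodic points and the scrambled set are written down explicitly.

Snap-back: `ψ` has slope `-2` on `[-δ, δ]`, so the derivative is `-2` times the identity on the ball
of radius `δ`. The point `(0, δ)` on its boundary goes to `(0, -2δ)` and then to `pStar`. Points
near `(0, δ)` return near `pStar` in two steps and are then doubled away from it; fixing the return
time `n` gives a linear equation whose solution has least period `n` (`exists_minimalPeriod_eq`).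

Scrambling: in units of `δ`, each step flips the sign and applies the tent map `T x = 2 min x (2 -
x)` to the absolute value, as long as the rounded corner `x = 1` is avoided. An orbit near `1`
passes near `2` and then near `0`, so its itinerary contains two consecutive zeros. Forbidding `00`
therefore keeps orbits out of a fixed neighbourhood of the corner (`IsGoldenMean`,
`smoothPsi_tentPoint`). Zeros placed at `⌊α 4ᵐ⌋` with `1 ≤ α < 2` give uncountably many such
itineraries: long common blocks of ones make the orbits proximal, while distinct shifts disagree
infinitely often (`eq_of_eventually_sparseSeq_eq`), which keeps every limsup positive.

Closeness to `minimalMap` holds because both maps fix `pStar` and are continuous there, and they are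
mixed only in a ball of radius `O(δ)`. So `δ` depends on `ε` alone, and the rounding scale `c` on
`η` and `δ`. -/

namespace RSFlipFlop

/-! ### Rounding the corners of `psi` and `sigma` -/

/-- A smooth version of `u ↦ max u 0`, equal to it outside `(c / 2, c)` and not above it. -/
noncomputable def smoothRamp (c u : ℝ) : ℝ := u * Real.smoothTransition (2 * u / c - 1)

theorem contDiff_smoothRamp (c : ℝ) : ContDiff ℝ ∞ (smoothRamp c) := by
  unfold smoothRamp
  exact contDiff_id.mul (Real.smoothTransition.contDiff.comp (by fun_prop))

theorem smoothRamp_of_le {c u : ℝ} (hc : 0 < c) (hu : u ≤ c / 2) : smoothRamp c u = 0 := by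
  rw [smoothRamp, Real.smoothTransition.zero_of_nonpos, mul_zero]
  rw [sub_nonpos, div_le_one hc]
  linarith

theorem smoothRamp_of_ge {c u : ℝ} (hc : 0 < c) (hu : c ≤ u) : smoothRamp c u = u := by
  rw [smoothRamp, Real.smoothTransition.one_of_one_le, mul_one]
  rw [le_sub_iff_add_le, le_div_iff₀ hc]
  linarith

theorem smoothRamp_nonneg {c : ℝ} (hc : 0 < c) (u : ℝ) : 0 ≤ smoothRamp c u := by
  rcases le_total u 0 with hu | hu
  · rw [smoothRamp_of_le hc (by linarith)]
  · exact mul_nonneg hu (Real.smoothTransition.nonneg _)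

theorem smoothRamp_le {c : ℝ} (hc : 0 < c) (u : ℝ) : smoothRamp c u ≤ max u 0 := by
  rcases le_total u 0 with hu | hu
  · rw [smoothRamp_of_le hc (by linarith)]
    exact le_max_right _ _
  · exact (mul_le_of_le_one_right hu (Real.smoothTransition.le_one _)).trans (le_max_left _ _)

theorem le_smoothRamp {c : ℝ} (hc : 0 < c) (u : ℝ) : max u 0 - c ≤ smoothRamp c u := by
  rcases le_total c u with hu | hu
  · rw [smoothRamp_of_ge hc hu, max_eq_left (by linarith)]
    linarith
  · have := smoothRamp_nonneg hc u
    have : max u 0 ≤ c := max_le hu hc.le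
    linarith

theorem smoothRamp_eq_max {c u : ℝ} (hc : 0 < c) (hu : c ≤ |u|) : smoothRamp c u = max u 0 := by
  rcases le_abs.mp hu with h | h
  · rw [smoothRamp_of_ge hc h, max_eq_left (by linarith)]
  · rw [smoothRamp_of_le hc (by linarith), max_eq_right (by linarith)]

/-- An odd smoothing of `psi δ` which is still linear slightly beyond the corners `±δ`. -/
noncomputable def smoothPsi (δ c t : ℝ) : ℝ :=
  -2 * t + 4 * smoothRamp c (t - δ) - 3 * smoothRamp c (t - 3 * δ)
    - 4 * smoothRamp c (-t - δ) + 3 * smoothRamp c (-t - 3 * δ)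

/-- The coefficients are the jumps of slope: `-2` to `2` at `δ`, `2` to `-1` at `3δ`, and their odd
reflections. Replacing each `max` by a ramp gives the smoothing. -/
theorem psi_eq_max {δ : ℝ} (hδ : 0 < δ) (t : ℝ) :
    psi δ t = -2 * t + 4 * max (t - δ) 0 - 3 * max (t - 3 * δ) 0
      - 4 * max (-t - δ) 0 + 3 * max (-t - 3 * δ) 0 := by
  unfold psi psiPos
  grind

theorem smoothPsi_neg (δ c t : ℝ) : smoothPsi δ c (-t) = -smoothPsi δ c t := by
  simp only [smoothPsi, neg_neg]
  ring

theorem contDiff_smoothPsi (δ c : ℝ) : ContDiff ℝ ∞ (smoothPsi δ c) := by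
  have h (g : ℝ → ℝ) (hg : ContDiff ℝ ∞ g) : ContDiff ℝ ∞ fun t => smoothRamp c (g t) :=
    (contDiff_smoothRamp c).comp hg
  have h1 := h (fun t => t - δ) (by fun_prop)
  have h2 := h (fun t => t - 3 * δ) (by fun_prop)
  have h3 := h (fun t => -t - δ) (by fun_prop)
  have h4 := h (fun t => -t - 3 * δ) (by fun_prop)
  unfold smoothPsi
  fun_prop

theorem isCornerSmoothing_smoothPsi {δ c η : ℝ} (hδ : 0 < δ) (hc : 0 < c) (hη : 20 * c < η) :
    IsCornerSmoothing η {δ, -δ, 3 * δ, -(3 * δ)} (psi δ) (smoothPsi δ c) := by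
  refine ⟨contDiff_smoothPsi δ c, fun u => ?_, fun u hu => ?_⟩
  -- Each ramp errs by at most `c`, and the coefficients sum to `4 + 3 + 4 + 3 = 14 < 20` in
  -- absolute value.
  · rw [psi_eq_max hδ, smoothPsi, abs_lt]
    have h1 := smoothRamp_le hc (u - δ)
    have h2 := smoothRamp_le hc (u - 3 * δ)
    have h3 := smoothRamp_le hc (-u - δ)
    have h4 := smoothRamp_le hc (-u - 3 * δ)
    have h1' := le_smoothRamp hc (u - δ)
    have h2' := le_smoothRamp hc (u - 3 * δ)
    have h3' := le_smoothRamp hc (-u - δ)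
    have h4' := le_smoothRamp hc (-u - 3 * δ)
    constructor <;> linarith
  · have h1 := hu δ (by simp)
    have h2 := hu (3 * δ) (by simp)
    have h3 := hu (-δ) (by simp)
    have h4 := hu (-(3 * δ)) (by simp)
    rw [abs_sub_comm, show -δ - u = -u - δ by ring] at h3
    rw [abs_sub_comm, show -(3 * δ) - u = -u - 3 * δ by ring] at h4
    rw [psi_eq_max hδ, smoothPsi, smoothRamp_eq_max hc (by linarith),
      smoothRamp_eq_max hc (by linarith), smoothRamp_eq_max hc (by linarith),
      smoothRamp_eq_max hc (by linarith)]

/-- The margin `c / 2` is available because the ramp bends only to the right of its corner. It makes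
the derivative `-2` on the whole closed ball of radius `δ`, and leaves room for periodic points
slightly beyond `δ`. -/
theorem smoothPsi_inner {δ c t : ℝ} (hδ : 0 < δ) (hc : 0 < c) (ht : |t| ≤ δ + c / 2) :
    smoothPsi δ c t = -2 * t := by
  rw [abs_le] at ht
  rw [smoothPsi, smoothRamp_of_le hc (by linarith), smoothRamp_of_le hc (by linarith),
    smoothRamp_of_le hc (by linarith), smoothRamp_of_le hc (by linarith)]
  ring

theorem smoothPsi_middle {δ c t : ℝ} (hδ : 0 < δ) (hc : 0 < c) (h1 : δ + c ≤ t)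
    (h2 : t ≤ 3 * δ) : smoothPsi δ c t = 2 * (t - 2 * δ) := by
  rw [smoothPsi, smoothRamp_of_ge hc (by linarith), smoothRamp_of_le hc (by linarith),
    smoothRamp_of_le hc (by linarith), smoothRamp_of_le hc (by linarith)]
  ring

theorem smoothPsi_outer {δ c t : ℝ} (hδ : 0 < δ) (hc : 0 < c) (h1 : 3 * δ + c ≤ t) :
    smoothPsi δ c t = 5 * δ - t := by
  rw [smoothPsi, smoothRamp_of_ge hc (by linarith), smoothRamp_of_ge hc (by linarith),
    smoothRamp_of_le hc (by linarith), smoothRamp_of_le hc (by linarith)]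
  ring

theorem abs_smoothPsi_le {δ c : ℝ} (hδ : 0 < δ) (hc : 0 < c) (t : ℝ) :
    |smoothPsi δ c t| ≤ 16 * |t| := by
  have key (k : ℝ) (hk : 0 < k) (s : ℝ) (hs : s ≤ |t|) : smoothRamp c (s - k) ≤ |t| :=
    (smoothRamp_le hc _).trans (max_le (by linarith) (abs_nonneg t))
  have h1 := key δ hδ t (le_abs_self t)
  have h2 := key (3 * δ) (by linarith) t (le_abs_self t)
  have h3 := key δ hδ (-t) (neg_le_abs t)
  have h4 := key (3 * δ) (by linarith) (-t) (neg_le_abs t)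
  have h1' := smoothRamp_nonneg hc (t - δ)
  have h2' := smoothRamp_nonneg hc (t - 3 * δ)
  have h3' := smoothRamp_nonneg hc (-t - δ)
  have h4' := smoothRamp_nonneg hc (-t - 3 * δ)
  have := le_abs_self t
  have := neg_le_abs t
  rw [smoothPsi, abs_le]
  constructor <;> linarith

/-- A smoothing of `sigma δ` with values in `[0, 1]`. -/
noncomputable def smoothSigma (δ c r : ℝ) : ℝ :=
  (1 / (δ * Real.sqrt 2)) * (smoothRamp c (r - 5 * δ * Real.sqrt 2)
    + (6 * δ * Real.sqrt 2 - r - smoothRamp c (6 * δ * Real.sqrt 2 - r)))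

theorem contDiff_smoothSigma (δ c : ℝ) : ContDiff ℝ ∞ (smoothSigma δ c) := by
  have h (g : ℝ → ℝ) (hg : ContDiff ℝ ∞ g) : ContDiff ℝ ∞ fun t => smoothRamp c (g t) :=
    (contDiff_smoothRamp c).comp hg
  have h1 := h (fun r => r - 5 * δ * Real.sqrt 2) (by fun_prop)
  have h2 := h (fun r => 6 * δ * Real.sqrt 2 - r) (by fun_prop)
  unfold smoothSigma
  fun_prop

theorem one_lt_sqrt_two : 1 < Real.sqrt 2 := by
  rw [Real.lt_sqrt] <;> norm_num

theorem sqrt_two_lt : Real.sqrt 2 < 3 / 2 := by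
  rw [Real.sqrt_lt'] <;> norm_num

/-- The second corner uses the reflected ramp, so that both roundings fall strictly between the two
corners. The smoothing is then exactly `0` and `1` outside and stays in `[0, 1]`. -/
theorem sigma_eq_max {δ : ℝ} (hδ : 0 < δ) (r : ℝ) :
    sigma δ r = (1 / (δ * Real.sqrt 2)) * (max (r - 5 * δ * Real.sqrt 2) 0
      + (6 * δ * Real.sqrt 2 - r - max (6 * δ * Real.sqrt 2 - r) 0)) := by
  have h : 0 < δ * Real.sqrt 2 := by positivity
  have h' : (1 / (δ * Real.sqrt 2)) * (δ * Real.sqrt 2) = 1 := by field_simp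
  unfold sigma
  split_ifs with h1 h2
  · rw [max_eq_right (by linarith), max_eq_left (by linarith)]
    ring
  · rw [max_eq_left (by linarith), max_eq_left (by linarith)]
    ring
  · rw [max_eq_left (by linarith), max_eq_right (by linarith)]
    linear_combination -h'

theorem smoothSigma_of_le {δ c r : ℝ} (hδ : 0 < δ) (hc : 0 < c) (hcδ : 2 * c ≤ δ)
    (hr : r ≤ 5 * δ * Real.sqrt 2 + c / 2) :
    smoothSigma δ c r = 0 := by
  have h : δ < δ * Real.sqrt 2 := lt_mul_of_one_lt_right hδ one_lt_sqrt_two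
  rcases le_total c (6 * δ * Real.sqrt 2 - r) with h1 | h1
  · rw [smoothSigma, smoothRamp_of_le hc (by linarith), smoothRamp_of_ge hc h1]
    ring
  · rw [smoothSigma, smoothRamp_of_le hc (by linarith), smoothRamp_of_ge hc (by linarith)]
    ring

theorem smoothSigma_of_ge {δ c r : ℝ} (hδ : 0 < δ) (hc : 0 < c) (hcδ : 2 * c ≤ δ)
    (hr : 6 * δ * Real.sqrt 2 ≤ r) :
    smoothSigma δ c r = 1 := by
  have h : δ < δ * Real.sqrt 2 := lt_mul_of_one_lt_right hδ one_lt_sqrt_two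
  rw [smoothSigma, smoothRamp_of_ge hc (by linarith), smoothRamp_of_le hc (by linarith)]
  have : δ * Real.sqrt 2 ≠ 0 := by positivity
  field_simp
  ring

theorem smoothSigma_mem {δ c : ℝ} (hδ : 0 < δ) (hc : 0 < c) (hcδ : 2 * c ≤ δ) (r : ℝ) :
    smoothSigma δ c r ∈ Icc (0 : ℝ) 1 := by
  have h : 0 < δ * Real.sqrt 2 := by positivity
  rcases le_total r (5 * δ * Real.sqrt 2) with h1 | h1
  · rw [smoothSigma_of_le hδ hc hcδ (by linarith)]
    simp
  rcases le_total (6 * δ * Real.sqrt 2) r with h2 | h2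
  · rw [smoothSigma_of_ge hδ hc hcδ h2]
    simp
  have a1 := smoothRamp_nonneg hc (r - 5 * δ * Real.sqrt 2)
  have a2 := smoothRamp_le hc (r - 5 * δ * Real.sqrt 2)
  have b1 := smoothRamp_nonneg hc (6 * δ * Real.sqrt 2 - r)
  have b2 := smoothRamp_le hc (6 * δ * Real.sqrt 2 - r)
  rw [max_eq_left (by linarith)] at a2 b2
  rw [smoothSigma, one_div_mul_eq_div]
  exact ⟨div_nonneg (by linarith) h.le, (div_le_one h).mpr (by linarith)⟩

theorem isCornerSmoothing_smoothSigma {δ c η : ℝ} (hδ : 0 < δ) (hc : 0 < c) (hη : 20 * c < η)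
    (hη' : 20 * c < η * δ) :
    IsCornerSmoothing η {5 * δ * Real.sqrt 2, 6 * δ * Real.sqrt 2} (sigma δ)
      (smoothSigma δ c) := by
  have h : δ < δ * Real.sqrt 2 := lt_mul_of_one_lt_right hδ one_lt_sqrt_two
  refine ⟨contDiff_smoothSigma δ c, fun u => ?_, fun u hu => ?_⟩
  · have a1 := le_smoothRamp hc (u - 5 * δ * Real.sqrt 2)
    have a2 := smoothRamp_le hc (u - 5 * δ * Real.sqrt 2)
    have b1 := le_smoothRamp hc (6 * δ * Real.sqrt 2 - u)
    have b2 := smoothRamp_le hc (6 * δ * Real.sqrt 2 - u)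
    rw [sigma_eq_max hδ, smoothSigma, ← mul_sub, abs_mul, abs_of_pos (by positivity),
      one_div_mul_eq_div, div_lt_iff₀ (by positivity)]
    have : η * δ < η * (δ * Real.sqrt 2) := mul_lt_mul_of_pos_left h (by linarith)
    rw [abs_lt]
    constructor <;> linarith
  · have h1 := hu (5 * δ * Real.sqrt 2) (by simp)
    have h2 := hu (6 * δ * Real.sqrt 2) (by simp)
    rw [abs_sub_comm] at h2
    rw [sigma_eq_max hδ, smoothSigma, smoothRamp_eq_max hc (by linarith),
      smoothRamp_eq_max hc (by linarith)]

/-! ### The `(s, t)`-coordinates and the norm -/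

theorem sCoord_ofST (s t : ℝ) : sCoord (ofST s t) = s := by
  have h2 : Real.sqrt 2 ^ 2 = 2 := Real.sq_sqrt (by norm_num)
  simp [sCoord, ofST]
  field_simp
  rw [h2]
  ring

theorem tCoord_ofST (s t : ℝ) : tCoord (ofST s t) = t := by
  have h2 : Real.sqrt 2 ^ 2 = 2 := Real.sq_sqrt (by norm_num)
  simp [tCoord, ofST]
  field_simp
  rw [h2]
  ring

theorem dist_ofST (s t s' t' : ℝ) :
    dist (ofST s t) (ofST s' t') = Real.sqrt ((s - s') ^ 2 + (t - t') ^ 2) := by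
  have h2 : Real.sqrt 2 ^ 2 = 2 := Real.sq_sqrt (by norm_num)
  rw [EuclideanSpace.dist_eq, Fin.sum_univ_two, Real.dist_eq, Real.dist_eq, sq_abs, sq_abs]
  congr 1
  simp [ofST]
  field_simp
  rw [h2]
  ring

theorem ofST_zero : ofST 0 0 = pStar := by
  simp [ofST, pStar]

theorem norm_ofST_sub (s t : ℝ) : ‖ofST s t - pStar‖ = Real.sqrt (s ^ 2 + t ^ 2) := by
  rw [← dist_eq_norm, ← ofST_zero, dist_ofST]
  simp

theorem norm_axis_sub (t : ℝ) : ‖ofST 0 t - pStar‖ = |t| := by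
  rw [norm_ofST_sub]
  simp [Real.sqrt_sq_eq_abs]

theorem edist_axis (t t' : ℝ) : edist (ofST 0 t) (ofST 0 t') = ENNReal.ofReal |t - t'| := by
  rw [edist_dist, dist_ofST]
  simp [Real.sqrt_sq_eq_abs]

theorem ofST_inj {t t' : ℝ} : ofST 0 t = ofST 0 t' ↔ t = t' :=
  ⟨fun h => by rw [← tCoord_ofST 0 t, h, tCoord_ofST], fun h => by rw [h]⟩

theorem norm_sub_pStar (p : Plane) : ‖p - pStar‖ = Real.sqrt (sCoord p ^ 2 + tCoord p ^ 2) := by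
  conv_lhs => rw [← ofST_coords p]
  exact norm_ofST_sub _ _

theorem abs_sCoord_le (p : Plane) : |sCoord p| ≤ ‖p - pStar‖ := by
  rw [norm_sub_pStar]
  exact Real.abs_le_sqrt (by nlinarith [sq_nonneg (tCoord p)])

theorem abs_tCoord_le (p : Plane) : |tCoord p| ≤ ‖p - pStar‖ := by
  rw [norm_sub_pStar]
  exact Real.abs_le_sqrt (by nlinarith [sq_nonneg (sCoord p)])

theorem norm_ofST_sub_le (s t : ℝ) : ‖ofST s t - pStar‖ ≤ |s| + |t| := by
  rw [norm_ofST_sub]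
  refine Real.sqrt_le_iff.mpr ⟨by positivity, ?_⟩
  rw [← sq_abs s, ← sq_abs t]
  nlinarith [abs_nonneg s, abs_nonneg t]

theorem abs_apply_sub_le (p : Plane) (i : Fin 2) : |p i - xStar| ≤ ‖p - pStar‖ := by
  have h := EuclideanSpace.norm_eq (p - pStar)
  have : pStar i = xStar := by fin_cases i <;> simp [pStar]
  rw [h, ← this]
  refine Real.abs_le_sqrt ?_
  have h2 := Finset.single_le_sum (f := fun j => ‖(p - pStar) j‖ ^ 2)
    (fun j _ => by positivity) (Finset.mem_univ i)
  simpa using h2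

/-! ### The minimal model map -/

theorem xStar_bounds : 3 / 8 < xStar ∧ xStar < 2 / 5 := by
  have h1 : (11 / 5 : ℝ) < Real.sqrt 5 := by rw [Real.lt_sqrt] <;> norm_num
  have h2 : Real.sqrt 5 < 9 / 4 := by rw [Real.sqrt_lt'] <;> norm_num
  unfold xStar
  constructor <;> linarith

theorem xStar_eq : xStar ^ 2 - 3 * xStar + 1 = 0 := by
  have h : Real.sqrt 5 ^ 2 = 5 := Real.sq_sqrt (by norm_num)
  unfold xStar
  linear_combination h / 4

theorem denom_pos {p : Plane} (hp : p ∈ mapDomain) : 0 < p 0 + p 1 - p 0 * p 1 := by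
  obtain ⟨⟨⟨h1, h2⟩, h3, h4⟩, h5⟩ := hp
  have h : 0 < p 0 ∨ 0 < p 1 := by
    by_contra! h
    refine h5 ?_
    ext i
    fin_cases i
    · simpa using le_antisymm h.1 h1
    · simpa using le_antisymm h.2 h3
  rcases h with h | h
  · nlinarith [mul_nonneg h3 (sub_nonneg.mpr h2)]
  · nlinarith [mul_nonneg h1 (sub_nonneg.mpr h4)]

theorem phaseSpace_subset : phaseSpace ⊆ mapDomain := fun _ hp =>
  ⟨hp.1, fun h => hp.2 (Or.inl h)⟩

theorem contDiffAt_minimalMap {p : Plane} (hp : p 0 + p 1 - p 0 * p 1 ≠ 0) :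
    ContDiffAt ℝ ∞ minimalMap p := by
  have hx (i : Fin 2) : ContDiffAt ℝ ∞ (fun q : Plane => q i) p := by fun_prop
  rw [contDiffAt_euclidean]
  intro i
  fin_cases i
  · simp only [minimalMap]
    simp
    exact ((hx 1).mul (contDiffAt_const.sub (hx 0))).div
      (((hx 0).add (hx 1)).sub ((hx 0).mul (hx 1))) hp
  · simp only [minimalMap]
    simp
    exact ((hx 0).mul (contDiffAt_const.sub (hx 1))).div
      (((hx 0).add (hx 1)).sub ((hx 0).mul (hx 1))) hp

theorem minimalMap_mem_unitSquare {p : Plane} (hp : p ∈ mapDomain) :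
    minimalMap p ∈ unitSquare := by
  have hD := denom_pos hp
  obtain ⟨⟨⟨h1, h2⟩, h3, h4⟩, h5⟩ := hp
  refine ⟨⟨?_, ?_⟩, ?_, ?_⟩ <;> simp [minimalMap]
  · exact div_nonneg (mul_nonneg h3 (by linarith)) hD.le
  · rw [div_le_one hD]
    linarith
  · exact div_nonneg (mul_nonneg h1 (by linarith)) hD.le
  · rw [div_le_one hD]
    linarith

theorem minimalMap_mem_phaseSpace {p : Plane} (hp : p ∈ phaseSpace) :
    minimalMap p ∈ phaseSpace := by
  have hm := phaseSpace_subset hp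
  have hD := denom_pos hm
  refine ⟨minimalMap_mem_unitSquare hm, ?_⟩
  obtain ⟨⟨⟨h1, h2⟩, h3, h4⟩, h5⟩ := hp
  rintro (h | h)
  · have e0 := congrArg (fun q : Plane => q 0) h
    have e1 := congrArg (fun q : Plane => q 1) h
    simp [minimalMap, hD.ne'] at e0 e1
    refine h5 ?_
    rcases e0 with e0 | e0
    · have : p 0 = 0 := by
        rcases e1 with e1 | e1
        · exact e1
        · rw [e0] at e1
          norm_num at e1
      left
      ext i
      fin_cases i <;> simp [e0, this]
    · have e0' : p 0 = 1 := by linarith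
      have : p 1 = 1 := by
        rcases e1 with e1 | e1
        · rw [e0'] at e1
          norm_num at e1
        · linarith
      right
      ext i
      fin_cases i <;> simp [e0', this]
  · have e0 := congrArg (fun q : Plane => q 0) h
    have e1 := congrArg (fun q : Plane => q 1) h
    simp [minimalMap] at e0 e1
    rw [div_eq_one_iff_eq hD.ne'] at e0 e1
    refine h5 (Or.inl ?_)
    ext i
    fin_cases i <;> simp <;> linarith

theorem denom_pStar_ne : pStar 0 + pStar 1 - pStar 0 * pStar 1 ≠ 0 := by
  have := xStar_bounds
  simp [pStar]
  nlinarith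

theorem minimalMap_pStar : minimalMap pStar = pStar := by
  have h := denom_pStar_ne
  have e := xStar_eq
  simp [pStar] at h
  ext i
  fin_cases i
  · simp [minimalMap, pStar]
    rw [div_eq_iff h]
    linear_combination xStar * e
  · simp [minimalMap, pStar]
    rw [div_eq_iff h]
    linear_combination xStar * e

/-! ### Symbolic coding of the tent map -/

/-- The point of `[0, 2]` with itinerary `d` under the tent map `x ↦ 2 min x (2 - x)`, where the
digit `0` stands for `[0, 1]` and `1` for `[1, 2]`. -/
noncomputable def tentPoint (d : ℕ → ℝ) : ℝ :=
  ∑' n, 2 * d n * ∏ k ∈ Finset.range n, (1 - 2 * d k) / 2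

/-- The digits are `0` or `1`. -/
def IsBinary (d : ℕ → ℝ) : Prop := ∀ n, d n = 0 ∨ d n = 1

/-- Binary sequences without two consecutive zeros. -/
def IsGoldenMean (d : ℕ → ℝ) : Prop := IsBinary d ∧ ∀ n, d n = 0 → d (n + 1) = 1

theorem IsBinary.shift {d : ℕ → ℝ} (hd : IsBinary d) (i : ℕ) : IsBinary fun n => d (n + i) :=
  fun n => hd (n + i)

theorem IsGoldenMean.shift {d : ℕ → ℝ} (hd : IsGoldenMean d) (i : ℕ) :
    IsGoldenMean fun n => d (n + i) :=
  ⟨hd.1.shift i, fun n h => by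
    have := hd.2 (n + i) h
    rwa [show n + i + 1 = n + 1 + i by omega] at this⟩

theorem IsBinary.norm_term_le {d : ℕ → ℝ} (hd : IsBinary d) (n : ℕ) :
    ‖2 * d n * ∏ k ∈ Finset.range n, (1 - 2 * d k) / 2‖ ≤ 2 * (1 / 2) ^ n := by
  rw [norm_mul, norm_prod]
  have h1 (k : ℕ) : ‖(1 - 2 * d k) / 2‖ = 1 / 2 := by
    rcases hd k with h | h <;> norm_num [h]
  have h2 : ‖2 * d n‖ ≤ 2 := by
    rcases hd n with h | h <;> norm_num [h]
  simp only [h1, Finset.prod_const, Finset.card_range]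
  exact mul_le_mul_of_nonneg_right h2 (by positivity)

theorem IsBinary.summable {d : ℕ → ℝ} (hd : IsBinary d) :
    Summable fun n => 2 * d n * ∏ k ∈ Finset.range n, (1 - 2 * d k) / 2 :=
  Summable.of_norm_bounded (summable_geometric_two.mul_left 2) hd.norm_term_le

/-- The series is the infinite composition of the inverse branches `x ↦ x / 2` (digit `0`) and `x ↦
2 - x / 2` (digit `1`); this peels off the first one. -/
theorem IsBinary.tentPoint_eq {d : ℕ → ℝ} (hd : IsBinary d) :
    tentPoint d = 2 * d 0 + (1 - 2 * d 0) / 2 * tentPoint fun n => d (n + 1) := by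
  rw [tentPoint, hd.summable.tsum_eq_zero_add, tentPoint, ← tsum_mul_left]
  simp only [Finset.range_zero, Finset.prod_empty, mul_one, Finset.prod_range_succ']
  congr 1
  refine tsum_congr fun n => ?_
  ring

theorem IsBinary.tentPoint_of_zero {d : ℕ → ℝ} (hd : IsBinary d) (h : d 0 = 0) :
    tentPoint d = (tentPoint fun n => d (n + 1)) / 2 := by
  rw [hd.tentPoint_eq, h]
  ring

theorem IsBinary.tentPoint_of_one {d : ℕ → ℝ} (hd : IsBinary d) (h : d 0 = 1) :
    tentPoint d = 2 - (tentPoint fun n => d (n + 1)) / 2 := by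
  rw [hd.tentPoint_eq, h]
  ring

theorem IsBinary.abs_tentPoint_le {d : ℕ → ℝ} (hd : IsBinary d) : |tentPoint d| ≤ 4 := by
  have h := tsum_of_norm_bounded (summable_geometric_two.mul_left 2).hasSum hd.norm_term_le
  rw [tsum_mul_left, tsum_geometric_two] at h
  rw [← Real.norm_eq_abs]
  exact h.trans (by norm_num)

theorem IsBinary.tentPoint_mem {d : ℕ → ℝ} (hd : IsBinary d) : tentPoint d ∈ Icc (0 : ℝ) 2 := by
  -- Both inverse branches map the `r`-neighbourhood of `[0, 2]` into its `r / 2`-neighbourhood, so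
  -- the crude bound `4` improves to the sharp interval.
  have key (n : ℕ) : ∀ d, IsBinary d → |tentPoint d - 1| ≤ 1 + 4 * (1 / 2) ^ n := by
    induction n with
    | zero =>
      intro d hd
      have := abs_le.mp hd.abs_tentPoint_le
      rw [abs_le]
      constructor <;> linarith
    | succ n ih =>
      intro d hd
      have h := abs_le.mp (ih _ (hd.shift 1))
      rw [abs_le, pow_succ]
      rcases hd 0 with h0 | h0
      · rw [hd.tentPoint_of_zero h0]
        constructor <;> linarith
      · rw [hd.tentPoint_of_one h0]
        constructor <;> linarith
  have hlim : Tendsto (fun n : ℕ => 1 + 4 * (1 / 2 : ℝ) ^ n) atTop (nhds (1 + 4 * 0)) :=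
    ((tendsto_pow_atTop_nhds_zero_of_lt_one (by norm_num) (by norm_num)).const_mul 4).const_add 1
  have := abs_le.mp (ge_of_tendsto' hlim fun n => key n d hd)
  constructor <;> linarith

/-- A digit `0` is followed by `1`, whose branch has image `[1, 2]`, and halving gives at least `1 /
2`. Pulling this gap at `0` back gives a gap at `2`, then the gap `(7/8, 9/8)` around the corner. -/
theorem IsGoldenMean.half_le {d : ℕ → ℝ} (hd : IsGoldenMean d) : 1 / 2 ≤ tentPoint d := by
  have h1 := (hd.1.shift 1).tentPoint_mem
  rcases hd.1 0 with h0 | h0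
  · have h2 := ((hd.1.shift 1).shift 1).tentPoint_mem
    have h3 := (hd.1.shift 1).tentPoint_of_one (hd.2 0 h0)
    rw [hd.1.tentPoint_of_zero h0, h3]
    linarith [h2.2]
  · rw [hd.1.tentPoint_of_one h0]
    linarith [h1.2]

theorem IsGoldenMean.le_seven_fourths {d : ℕ → ℝ} (hd : IsGoldenMean d) :
    tentPoint d ≤ 7 / 4 := by
  have h1 := (hd.1.shift 1).tentPoint_mem
  have h2 := (hd.shift 1).half_le
  rcases hd.1 0 with h0 | h0
  · rw [hd.1.tentPoint_of_zero h0]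
    linarith [h1.2]
  · rw [hd.1.tentPoint_of_one h0]
    linarith

theorem IsGoldenMean.le_of_zero {d : ℕ → ℝ} (hd : IsGoldenMean d) (h : d 0 = 0) :
    tentPoint d ≤ 7 / 8 := by
  rw [hd.1.tentPoint_of_zero h]
  linarith [(hd.shift 1).le_seven_fourths]

theorem IsGoldenMean.le_of_one {d : ℕ → ℝ} (hd : IsGoldenMean d) (h : d 0 = 1) :
    9 / 8 ≤ tentPoint d := by
  rw [hd.1.tentPoint_of_one h]
  linarith [(hd.shift 1).le_seven_fourths]

theorem abs_tentPoint_sub_le (n : ℕ) : ∀ {d d' : ℕ → ℝ}, IsBinary d → IsBinary d' →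
    (∀ k < n, d k = d' k) → |tentPoint d - tentPoint d'| ≤ 2 * (1 / 2) ^ n := by
  induction n with
  | zero =>
    intro d d' hd hd' _
    have h1 := hd.tentPoint_mem
    have h2 := hd'.tentPoint_mem
    rw [abs_le]
    constructor <;> linarith [h1.1, h1.2, h2.1, h2.2]
  | succ n ih =>
    intro d d' hd hd' h
    have h1 := abs_le.mp (ih (hd.shift 1) (hd'.shift 1) fun k hk => h (k + 1) (by omega))
    have h0 := h 0 (by omega)
    rw [abs_le, pow_succ]
    rcases hd 0 with h2 | h2
    · rw [hd.tentPoint_of_zero h2, hd'.tentPoint_of_zero (h0 ▸ h2)]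
      constructor <;> linarith
    · rw [hd.tentPoint_of_one h2, hd'.tentPoint_of_one (h0 ▸ h2)]
      constructor <;> linarith

/-! ### Uncountably many sparse itineraries -/

/-- The position `⌊α 4ᵐ⌋` of the `m`-th zero in the sequence with parameter `α`. -/
noncomputable def zeroPos (α : ℝ) (m : ℕ) : ℕ := ⌊α * 4 ^ m⌋₊

open Classical in
/-- The sequence whose zeros are at the positions `⌊α 4ᵐ⌋`. -/
noncomputable def sparseSeq (α : ℝ) (n : ℕ) : ℝ := if ∃ m, zeroPos α m = n then 0 else 1

theorem le_zeroPos {α : ℝ} (hα : 1 ≤ α) (m : ℕ) : 4 ^ m ≤ zeroPos α m := by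
  refine Nat.le_floor ?_
  push_cast
  exact le_mul_of_one_le_left (by positivity) hα

theorem zeroPos_lt {α : ℝ} (hα : 1 ≤ α) (hα' : α < 2) (m : ℕ) : zeroPos α m < 2 * 4 ^ m := by
  rw [zeroPos, Nat.floor_lt (by positivity)]
  push_cast
  exact mul_lt_mul_of_pos_right hα' (by positivity)

theorem sparseSeq_eq_zero {α : ℝ} {n : ℕ} : sparseSeq α n = 0 ↔ ∃ m, zeroPos α m = n := by
  unfold sparseSeq
  split_ifs with h <;> simp [h]

theorem isBinary_sparseSeq (α : ℝ) : IsBinary (sparseSeq α) := fun n => by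
  unfold sparseSeq
  split_ifs <;> simp

theorem isGoldenMean_sparseSeq {α : ℝ} (hα : 1 ≤ α) (hα' : α < 2) :
    IsGoldenMean (sparseSeq α) := by
  refine ⟨isBinary_sparseSeq α, fun n hn => (isBinary_sparseSeq α (n + 1)).resolve_left ?_⟩
  intro h
  obtain ⟨m, hm⟩ := sparseSeq_eq_zero.mp hn
  obtain ⟨m', hm'⟩ := sparseSeq_eq_zero.mp h
  have a1 := le_zeroPos hα m
  have a2 := zeroPos_lt hα hα' m
  have a3 := le_zeroPos hα m'
  have a4 := zeroPos_lt hα hα' m'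
  rcases lt_trichotomy m m' with h | h | h
  · have : 4 ^ (m + 1) ≤ 4 ^ m' := Nat.pow_le_pow_right (by norm_num) h
    rw [pow_succ] at this
    have : 0 < 4 ^ m := by positivity
    omega
  · subst h
    omega
  · have : 4 ^ (m' + 1) ≤ 4 ^ m := Nat.pow_le_pow_right (by norm_num) h
    rw [pow_succ] at this
    have : 0 < 4 ^ m' := by positivity
    omega

theorem sparseSeq_of_between {α : ℝ} (hα : 1 ≤ α) (hα' : α < 2) {m n : ℕ} (h1 : 2 * 4 ^ m ≤ n)
    (h2 : n < 4 ^ (m + 1)) : sparseSeq α n = 1 := by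
  refine (isBinary_sparseSeq α n).resolve_left fun h => ?_
  obtain ⟨m', hm'⟩ := sparseSeq_eq_zero.mp h
  have a3 := le_zeroPos hα m'
  have a4 := zeroPos_lt hα hα' m'
  rcases lt_or_ge m m' with h | h
  · have : 4 ^ (m + 1) ≤ 4 ^ m' := Nat.pow_le_pow_right (by norm_num) h
    omega
  · have : 4 ^ m' ≤ 4 ^ m := Nat.pow_le_pow_right (by norm_num) h
    omega

/-- Shifts of two of the sparse sequences agree eventually only if they are the same shift of the
same sequence. -/
theorem eq_of_eventually_sparseSeq_eq {α β : ℝ} (hα : 1 ≤ α) (hα' : α < 2) (hβ : 1 ≤ β)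
    (hβ' : β < 2) {i j : ℕ} (h : ∀ᶠ k in atTop, sparseSeq α (k + i) = sparseSeq β (k + j)) :
    α = β ∧ i = j := by
  obtain ⟨K, hK⟩ := eventually_atTop.mp h
  -- The `m`-th zero lies in `[4 ^ m, 2 * 4 ^ m)`. For large `m` these blocks are farther apart than
  -- the shifts, so the `m`-th zeros must match each other.
  have key (m : ℕ) (hm : K + 4 * (i + j) + 1 ≤ m) : zeroPos α m + j = zeroPos β m + i := by
    have hm4 : m < 4 ^ m := Nat.lt_pow_self (by norm_num)
    have a1 := le_zeroPos hα m
    have a2 := zeroPos_lt hα hα' m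
    have h0 := hK (zeroPos α m - i) (by omega)
    rw [Nat.sub_add_cancel (by omega), sparseSeq_eq_zero.mpr ⟨m, rfl⟩, eq_comm,
      sparseSeq_eq_zero] at h0
    obtain ⟨m', hm'⟩ := h0
    have a3 := le_zeroPos hβ m'
    have a4 := zeroPos_lt hβ hβ' m'
    rcases lt_trichotomy m m' with h | h | h
    · have : 4 ^ (m + 1) ≤ 4 ^ m' := Nat.pow_le_pow_right (by norm_num) h
      rw [pow_succ] at this
      omega
    · subst h
      omega
    · have : 4 ^ (m' + 1) ≤ 4 ^ m := Nat.pow_le_pow_right (by norm_num) h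
      rw [pow_succ] at this
      omega
  -- Up to rounding, matching zeros means that `(α - β) * 4 ^ m` equals `i - j`, which is bounded in
  -- `m`.
  have hbd (m : ℕ) (hm : K + 4 * (i + j) + 1 ≤ m) : |α - β| * 4 ^ m ≤ 1 + i + j := by
    have e : (zeroPos α m : ℝ) + j = zeroPos β m + i := by exact_mod_cast key m hm
    have b1 := Nat.floor_le (show 0 ≤ α * 4 ^ m by positivity)
    have b2 := Nat.lt_floor_add_one (α * 4 ^ m)
    have b3 := Nat.floor_le (show 0 ≤ β * 4 ^ m by positivity)
    have b4 := Nat.lt_floor_add_one (β * 4 ^ m)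
    have hi : (0 : ℝ) ≤ i := by positivity
    have hj : (0 : ℝ) ≤ j := by positivity
    unfold zeroPos at e
    rw [← abs_of_pos (show (0 : ℝ) < 4 ^ m by positivity), ← abs_mul, sub_mul, abs_le]
    constructor <;> linarith
  have hαβ : α = β := by
    by_contra hne
    have hpos : 0 < |α - β| := abs_pos.mpr (sub_ne_zero.mpr hne)
    have hlim : Tendsto (fun m : ℕ => |α - β| * (4 : ℝ) ^ m) atTop atTop :=
      (tendsto_pow_atTop_atTop_of_one_lt (by norm_num)).const_mul_atTop hpos
    obtain ⟨m, h1, h2⟩ := ((hlim.eventually_gt_atTop (1 + i + j : ℝ)).and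
      (eventually_ge_atTop (K + 4 * (i + j) + 1))).exists
    exact absurd (hbd m h2) (not_le.mpr h1)
  refine ⟨hαβ, ?_⟩
  have := key _ le_rfl
  rw [hαβ] at this
  omega

/-! ### Reduction to one dimension on the `t`-axis -/

/-- The perturbed map for the smoothings `smoothPsi δ c` and `smoothSigma δ c`. -/
noncomputable abbrev smoothMap (δ c : ℝ) : Plane → Plane :=
  perturbedMap (smoothSigma δ c) (smoothPsi δ c)

theorem smoothMap_eq_snapMap {δ c : ℝ} (hδ : 0 < δ) (hc : 0 < c) (hcδ : 2 * c ≤ δ) {p : Plane}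
    (hp : ‖p - pStar‖ ≤ 5 * δ * Real.sqrt 2) : smoothMap δ c p = snapMap (smoothPsi δ c) p := by
  rw [smoothMap, perturbedMap, smoothSigma_of_le hδ hc hcδ (by linarith)]
  simp

theorem lt_five_mul_sqrt_two {δ : ℝ} (hδ : 0 < δ) : 5 * δ < 5 * δ * Real.sqrt 2 :=
  lt_mul_of_one_lt_right (by linarith) one_lt_sqrt_two

theorem smoothMap_axis {δ c : ℝ} (hδ : 0 < δ) (hc : 0 < c) (hcδ : 2 * c ≤ δ) {t : ℝ}
    (ht : |t| ≤ 5 * δ) : smoothMap δ c (ofST 0 t) = ofST 0 (smoothPsi δ c t) := by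
  rw [smoothMap_eq_snapMap hδ hc hcδ, snapMap, sCoord_ofST, tCoord_ofST]
  · simp [phi]
  · rw [norm_axis_sub]
    linarith [lt_five_mul_sqrt_two hδ]

theorem smoothMap_iterate_axis {δ c : ℝ} (hδ : 0 < δ) (hc : 0 < c) (hcδ : 2 * c ≤ δ)
    {y : ℕ → ℝ} {n : ℕ} (hy : ∀ k < n, |y k| ≤ 5 * δ ∧ smoothPsi δ c (y k) = y (k + 1)) :
    (smoothMap δ c)^[n] (ofST 0 (y 0)) = ofST 0 (y n) := by
  induction n with
  | zero => rfl
  | succ n ih =>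
    rw [iterate_succ_apply', ih fun k hk => hy k (by omega),
      smoothMap_axis hδ hc hcδ (hy n (by omega)).1, (hy n (by omega)).2]

theorem smoothPsi_middle_neg {δ c t : ℝ} (hδ : 0 < δ) (hc : 0 < c) (h1 : δ + c ≤ t)
    (h2 : t ≤ 3 * δ) : smoothPsi δ c (-t) = -(2 * (t - 2 * δ)) := by
  rw [smoothPsi_neg, smoothPsi_middle hδ hc h1 h2]

/-! ### Derivatives -/

/-- The matrix in the standard basis of the linear map `(s, t) ↦ (-2 s, a t)`. -/
noncomputable def snapMatrix (a : ℝ) : Matrix (Fin 2) (Fin 2) ℝ :=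
  !![(a - 2) / 2, (a + 2) / 2; (a + 2) / 2, (a - 2) / 2]

/-- The linear map `(s, t) ↦ (-2 s, a t)`. -/
noncomputable def snapLinear (a : ℝ) : Plane →L[ℝ] Plane :=
  LinearMap.toContinuousLinearMap (Matrix.toLin (EuclideanSpace.basisFun (Fin 2) ℝ).toBasis
    (EuclideanSpace.basisFun (Fin 2) ℝ).toBasis (snapMatrix a))

theorem snapLinear_apply_zero (a : ℝ) (v : Plane) :
    snapLinear a v 0 = (a - 2) / 2 * v 0 + (a + 2) / 2 * v 1 := by
  simp [snapLinear, Matrix.toLin_apply, snapMatrix, Matrix.mulVec, dotProduct, Fin.sum_univ_two]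

theorem snapLinear_apply_one (a : ℝ) (v : Plane) :
    snapLinear a v 1 = (a + 2) / 2 * v 0 + (a - 2) / 2 * v 1 := by
  simp [snapLinear, Matrix.toLin_apply, snapMatrix, Matrix.mulVec, dotProduct, Fin.sum_univ_two]

theorem det_snapLinear (a : ℝ) : (snapLinear a).det = -2 * a := by
  rw [ContinuousLinearMap.det, snapLinear, LinearMap.coe_toContinuousLinearMap,
    LinearMap.det_toLin, snapMatrix, Matrix.det_fin_two_of]
  ring

theorem charpoly_snapLinear_neg_two :
    (snapLinear (-2)).toLinearMap.charpoly = (Polynomial.X + 2) ^ 2 := by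
  rw [snapLinear, LinearMap.coe_toContinuousLinearMap, Matrix.charpoly_toLin,
    Matrix.charpoly_fin_two, snapMatrix, Matrix.det_fin_two_of, Matrix.trace_fin_two_of]
  norm_num
  simp only [map_ofNat]
  ring

theorem hasFDerivAt_snapMap {ψ : ℝ → ℝ} {a : ℝ} {p : Plane} (h : HasDerivAt ψ a (tCoord p)) :
    HasFDerivAt (snapMap ψ) (snapLinear a) p := by
  have h2 : Real.sqrt 2 ^ 2 = 2 := Real.sq_sqrt (by norm_num)
  have hx (i : Fin 2) : HasFDerivAt (fun q : Plane => q i)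
      (EuclideanSpace.proj i : Plane →L[ℝ] ℝ) p :=
    (EuclideanSpace.proj i : Plane →L[ℝ] ℝ).hasFDerivAt
  have hs : HasFDerivAt sCoord _ p := ((hx 0).sub (hx 1)).mul_const (Real.sqrt 2)⁻¹
  have ht : HasFDerivAt tCoord _ p :=
    (((hx 0).add (hx 1)).sub_const (2 * xStar)).mul_const (Real.sqrt 2)⁻¹
  have hψ := h.comp_hasFDerivAt p ht
  have hφ := hs.const_mul (-2)
  rw [← hasFDerivWithinAt_univ, hasFDerivWithinAt_euclidean]
  intro i
  rw [hasFDerivWithinAt_univ]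
  fin_cases i
  · refine (((hφ.add hψ).mul_const (Real.sqrt 2)⁻¹).const_add xStar).congr_fderiv ?_
    ext v
    simp [snapLinear_apply_zero]
    field_simp
    rw [h2]
    ring
  · refine (((hψ.sub hφ).mul_const (Real.sqrt 2)⁻¹).const_add xStar).congr_fderiv ?_
    ext v
    simp [snapLinear_apply_one]
    field_simp
    rw [h2]
    ring

theorem hasFDerivAt_smoothMap {δ c a : ℝ} (hδ : 0 < δ) (hc : 0 < c) (hcδ : 2 * c ≤ δ) {p : Plane}
    (hp : ‖p - pStar‖ ≤ 5 * δ) (ha : HasDerivAt (smoothPsi δ c) a (tCoord p)) :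
    HasFDerivAt (smoothMap δ c) (snapLinear a) p := by
  refine (hasFDerivAt_snapMap ha).congr_of_eventuallyEq ?_
  have : ∀ᶠ q in nhds p, ‖q - pStar‖ < 5 * δ * Real.sqrt 2 :=
    (by fun_prop : Continuous fun q : Plane => ‖q - pStar‖).continuousAt.eventually_lt_const
      (hp.trans_lt (lt_five_mul_sqrt_two hδ))
  filter_upwards [this] with q hq
  exact smoothMap_eq_snapMap hδ hc hcδ hq.le

theorem hasDerivAt_smoothPsi_inner {δ c t : ℝ} (hδ : 0 < δ) (hc : 0 < c) (ht : |t| ≤ δ) :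
    HasDerivAt (smoothPsi δ c) (-2) t := by
  have h : HasDerivAt (fun t : ℝ => -2 * t) (-2) t := by
    simpa using (hasDerivAt_id t).const_mul (-2)
  refine h.congr_of_eventuallyEq ?_
  have : ∀ᶠ u in nhds t, |u| < δ + c / 2 :=
    continuous_abs.continuousAt.eventually_lt_const (by linarith)
  filter_upwards [this] with u hu
  exact smoothPsi_inner hδ hc hu.le

theorem hasDerivAt_smoothPsi_middle {δ c t : ℝ} (hδ : 0 < δ) (hc : 0 < c) (h1 : δ + c < t)
    (h2 : t < 3 * δ) : HasDerivAt (smoothPsi δ c) 2 t := by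
  have h : HasDerivAt (fun t : ℝ => 2 * (t - 2 * δ)) 2 t := by
    simpa using ((hasDerivAt_id t).sub_const (2 * δ)).const_mul 2
  refine h.congr_of_eventuallyEq ?_
  filter_upwards [Ioo_mem_nhds h1 h2] with u hu
  exact smoothPsi_middle hδ hc hu.1.le hu.2.le

theorem hasDerivAt_smoothPsi_outer {δ c t : ℝ} (hδ : 0 < δ) (hc : 0 < c) (h1 : 3 * δ + c < t) :
    HasDerivAt (smoothPsi δ c) (-1) t := by
  have h : HasDerivAt (fun t : ℝ => 5 * δ - t) (-1) t := by
    simpa using (hasDerivAt_id t).const_sub (5 * δ)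
  refine h.congr_of_eventuallyEq ?_
  filter_upwards [Ioi_mem_nhds h1] with u hu
  exact smoothPsi_outer hδ hc (le_of_lt hu)

theorem hasDerivAt_smoothPsi_neg {δ c a t : ℝ} (h : HasDerivAt (smoothPsi δ c) a t) :
    HasDerivAt (smoothPsi δ c) a (-t) := by
  rw [← neg_neg t] at h
  have h1 := (h.comp (-t) (hasDerivAt_neg (-t))).neg
  have e : -(smoothPsi δ c ∘ Neg.neg) = smoothPsi δ c := by
    funext u
    simp [smoothPsi_neg]
  rw [e] at h1
  simpa using h1

/-! ### Snap-back points and expansion -/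

theorem isSnapBackPoint_axis {δ c a t : ℝ} (hδ : 0 < δ) (hc : 0 < c) (hcδ : 2 * c ≤ δ)
    (ht : |t| ≤ 5 * δ) (ht0 : t ≠ 0) (h0 : smoothPsi δ c t = 0)
    (ha : HasDerivAt (smoothPsi δ c) a t) (ha0 : a ≠ 0) :
    IsSnapBackPoint (smoothMap δ c) pStar (ofST 0 t) := by
  refine ⟨fun h => ht0 ?_, 1, one_pos, ?_, ?_⟩
  · rwa [← ofST_zero, ofST_inj] at h
  · rw [iterate_one, smoothMap_axis hδ hc hcδ ht, h0, ofST_zero]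
  · have h := hasFDerivAt_smoothMap hδ hc hcδ (p := ofST 0 t) (by rwa [norm_axis_sub])
      (by rwa [tCoord_ofST])
    rw [iterate_one, h.fderiv, det_snapLinear]
    simpa using ha0

theorem isSnapBackPoint_of_mem {δ c : ℝ} (hδ : 0 < δ) (hc : 0 < c) (hcδ : 2 * c ≤ δ) {q : Plane}
    (hq : q ∈ ({ofST 0 (2 * δ), ofST 0 (-(2 * δ)), ofST 0 (5 * δ), ofST 0 (-(5 * δ))} :
      Set Plane)) : IsSnapBackPoint (smoothMap δ c) pStar q := by
  have p2 : smoothPsi δ c (2 * δ) = 0 := by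
    rw [smoothPsi_middle hδ hc (by linarith) (by linarith)]
    ring
  have p5 : smoothPsi δ c (5 * δ) = 0 := by
    rw [smoothPsi_outer hδ hc (by linarith)]
    ring
  have d2 := hasDerivAt_smoothPsi_middle (t := 2 * δ) hδ hc (by linarith) (by linarith)
  have d5 := hasDerivAt_smoothPsi_outer (t := 5 * δ) hδ hc (by linarith)
  have a2 : |2 * δ| ≤ 5 * δ := by rw [abs_of_pos (by positivity)]; linarith
  have a5 : |5 * δ| ≤ 5 * δ := (abs_of_pos (by positivity)).le
  rcases hq with rfl | rfl | rfl | rfl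
  · exact isSnapBackPoint_axis hδ hc hcδ a2 (by positivity) p2 d2 (by norm_num)
  · exact isSnapBackPoint_axis hδ hc hcδ (by rwa [abs_neg]) (neg_ne_zero.mpr (by positivity))
      (by rw [smoothPsi_neg, p2, neg_zero]) (hasDerivAt_smoothPsi_neg d2) (by norm_num)
  · exact isSnapBackPoint_axis hδ hc hcδ a5 (by positivity) p5 d5 (by norm_num)
  · exact isSnapBackPoint_axis hδ hc hcδ (by rwa [abs_neg]) (neg_ne_zero.mpr (by positivity))
      (by rw [smoothPsi_neg, p5, neg_zero]) (hasDerivAt_smoothPsi_neg d5) (by norm_num)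

theorem smoothMap_pStar {δ c : ℝ} (hδ : 0 < δ) (hc : 0 < c) (hcδ : 2 * c ≤ δ) :
    smoothMap δ c pStar = pStar := by
  rw [← ofST_zero, smoothMap_axis hδ hc hcδ (by simpa using hδ.le),
    smoothPsi_inner hδ hc (by rw [abs_zero]; positivity), mul_zero]

theorem isExpandingFixedPt_smoothMap {δ c : ℝ} (hδ : 0 < δ) (hc : 0 < c) (hcδ : 2 * c ≤ δ) :
    IsExpandingFixedPt (smoothMap δ c) pStar δ := by
  refine ⟨smoothMap_pStar hδ hc hcδ, fun x hx => ?_⟩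
  rw [mem_closedBall_iff_norm] at hx
  have h := hasFDerivAt_smoothMap hδ hc hcδ (p := x) (by linarith)
    (hasDerivAt_smoothPsi_inner hδ hc ((abs_tCoord_le x).trans hx))
  refine ⟨h.differentiableAt, fun μ hμ => ?_⟩
  rw [h.fderiv, charpoly_snapLinear_neg_two] at hμ
  have : μ = -2 := by
    simp [Polynomial.IsRoot] at hμ
    linear_combination hμ
  rw [this]
  norm_num

theorem isSnapBackPoint_corner {δ c : ℝ} (hδ : 0 < δ) (hc : 0 < c) (hcδ : 2 * c ≤ δ) :
    IsSnapBackPoint (smoothMap δ c) pStar (ofST 0 δ) := by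
  have e1 : smoothMap δ c (ofST 0 δ) = ofST 0 (-(2 * δ)) := by
    rw [smoothMap_axis hδ hc hcδ (by rw [abs_of_pos hδ]; linarith),
      smoothPsi_inner hδ hc (by rw [abs_of_pos hδ]; linarith)]
    ring_nf
  have e2 : smoothMap δ c (ofST 0 (-(2 * δ))) = pStar := by
    rw [smoothMap_axis hδ hc hcδ (by rw [abs_neg, abs_of_pos (by positivity)]; linarith),
      smoothPsi_middle_neg hδ hc (by linarith) (by linarith), sub_self, mul_zero, neg_zero,
      ofST_zero]
  refine ⟨fun h => hδ.ne' ?_, 2, two_pos, ?_, ?_⟩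
  · rwa [← ofST_zero, ofST_inj] at h
  · rw [iterate_succ_apply, iterate_one, e1, e2]
  · have h1 := hasFDerivAt_smoothMap hδ hc hcδ (p := ofST 0 δ)
      (by rw [norm_axis_sub, abs_of_pos hδ]; linarith)
      (hasDerivAt_smoothPsi_inner hδ hc (by rw [tCoord_ofST, abs_of_pos hδ]))
    have h2 := hasFDerivAt_smoothMap hδ hc hcδ (p := ofST 0 (-(2 * δ))) (a := 2)
      (by rw [norm_axis_sub, abs_neg, abs_of_pos] <;> linarith)
      (by
        rw [tCoord_ofST]
        exact hasDerivAt_smoothPsi_neg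
          (hasDerivAt_smoothPsi_middle hδ hc (by linarith) (by linarith)))
    rw [← e1] at h2
    have h := (h2.comp (ofST 0 δ) h1).fderiv
    rw [show (smoothMap δ c)^[2] = smoothMap δ c ∘ smoothMap δ c from rfl, h,
      ContinuousLinearMap.det, ContinuousLinearMap.toLinearMap_comp, LinearMap.det_comp]
    have d1 := det_snapLinear (-2)
    have d2 := det_snapLinear 2
    rw [ContinuousLinearMap.det] at d1 d2
    rw [d1, d2]
    norm_num

theorem closedBall_subset_phaseSpace {r : ℝ} (hr : r ≤ 1 / 4) :
    Metric.closedBall pStar r ⊆ phaseSpace := by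
  intro p hp
  rw [mem_closedBall_iff_norm] at hp
  have h0 := abs_le.mp ((abs_apply_sub_le p 0).trans (hp.trans hr))
  have h1 := abs_le.mp ((abs_apply_sub_le p 1).trans (hp.trans hr))
  have hx := xStar_bounds
  refine ⟨⟨⟨by linarith, by linarith⟩, by linarith, by linarith⟩, ?_⟩
  rintro (h | h)
  · have := congrArg (fun q : Plane => q 0) h
    simp at this
    linarith
  · have := congrArg (fun q : Plane => q 0) h
    simp at this
    linarith

theorem isSnapBackRepeller_smoothMap {δ c : ℝ} (hδ : 0 < δ) (hδ' : δ ≤ 1 / 4) (hc : 0 < c)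
    (hcδ : 2 * c ≤ δ) : IsSnapBackRepeller (smoothMap δ c) phaseSpace pStar := by
  refine ⟨δ, hδ, closedBall_subset_phaseSpace hδ', isExpandingFixedPt_smoothMap hδ hc hcδ,
    ofST 0 δ, ?_, isSnapBackPoint_corner hδ hc hcδ⟩
  rw [mem_closedBall_iff_norm, norm_axis_sub, abs_of_pos hδ]

/-! ### Regularity, invariance, and closeness to the minimal model map -/

theorem contDiffOn_smoothMap {δ c : ℝ} (hδ : 0 < δ) (hc : 0 < c) (hcδ : 2 * c ≤ δ) :
    ContDiffOn ℝ ∞ (smoothMap δ c) mapDomain := by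
  intro p hp
  have hσ : ContDiffAt ℝ ∞ (fun q : Plane => smoothSigma δ c ‖q - pStar‖) p := by
    rcases eq_or_ne p pStar with rfl | hne
    -- The norm is not differentiable at `pStar`, but the cut-off vanishes near it.
    · refine (contDiffAt_const (c := (0 : ℝ))).congr_of_eventuallyEq ?_
      have : ∀ᶠ q in nhds pStar, ‖q - pStar‖ < 5 * δ * Real.sqrt 2 :=
        (by fun_prop : Continuous fun q : Plane => ‖q - pStar‖).continuousAt.eventually_lt_const
          (by simp only [sub_self, norm_zero]; positivity)
      filter_upwards [this] with q hq
      exact smoothSigma_of_le hδ hc hcδ (by linarith)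
    · exact (contDiff_smoothSigma δ c).contDiffAt.comp p
        ((contDiffAt_id.sub contDiffAt_const).norm ℝ (sub_ne_zero.mpr hne))
  have hx (i : Fin 2) : ContDiffAt ℝ ∞ (fun q : Plane => q i) p := by fun_prop
  have hs : ContDiffAt ℝ ∞ sCoord p := ((hx 0).sub (hx 1)).div_const _
  have ht : ContDiffAt ℝ ∞ tCoord p := (((hx 0).add (hx 1)).sub contDiffAt_const).div_const _
  have hψ : ContDiffAt ℝ ∞ (fun q => smoothPsi δ c (tCoord q)) p :=
    (contDiff_smoothPsi δ c).contDiffAt.comp p ht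
  have hφ : ContDiffAt ℝ ∞ (fun q => phi (sCoord q)) p := contDiffAt_const.mul hs
  have hR : ContDiffAt ℝ ∞ (snapMap (smoothPsi δ c)) p := by
    rw [contDiffAt_euclidean]
    intro i
    fin_cases i
    · exact contDiffAt_const.add ((hφ.add hψ).div_const _)
    · exact contDiffAt_const.add ((hψ.sub hφ).div_const _)
  exact (((contDiffAt_const.sub hσ).smul hR).add
    (hσ.smul (contDiffAt_minimalMap (denom_pos hp).ne'))).contDiffWithinAt

theorem norm_snapMap_sub_le {δ c : ℝ} (hδ : 0 < δ) (hc : 0 < c) (p : Plane) :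
    ‖snapMap (smoothPsi δ c) p - pStar‖ ≤ 18 * ‖p - pStar‖ := by
  refine (norm_ofST_sub_le _ _).trans ?_
  have h1 := abs_sCoord_le p
  have h2 := abs_tCoord_le p
  have h3 := abs_smoothPsi_le hδ hc (tCoord p)
  rw [phi, abs_mul, show |(-2 : ℝ)| = 2 by norm_num]
  linarith

theorem six_mul_sqrt_two_lt {δ : ℝ} (hδ : 0 < δ) : 6 * δ * Real.sqrt 2 < 9 * δ := by
  nlinarith [sqrt_two_lt]

/-- A convex combination giving positive weight to an interior point of the square is interior,
hence not one of the removed corners. -/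
theorem combo_mem_phaseSpace {p q : Plane} {s : ℝ} (hs : 0 ≤ s) (hs' : s < 1)
    (hp : ‖p - pStar‖ ≤ 1 / 4) (hq : q ∈ unitSquare) : (1 - s) • p + s • q ∈ phaseSpace := by
  have h0 := abs_le.mp ((abs_apply_sub_le p 0).trans hp)
  have h1 := abs_le.mp ((abs_apply_sub_le p 1).trans hp)
  have hx := xStar_bounds
  obtain ⟨⟨q1, q2⟩, q3, q4⟩ := hq
  have key (a b : ℝ) (ha : 0 < a) (ha' : a < 1) (hb : 0 ≤ b) (hb' : b ≤ 1) :
      0 < (1 - s) * a + s * b ∧ (1 - s) * a + s * b < 1 := by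
    constructor
    · have := mul_pos (sub_pos.mpr hs') ha
      have := mul_nonneg hs hb
      linarith
    · have := mul_pos (sub_pos.mpr hs') (sub_pos.mpr ha')
      have := mul_nonneg hs (sub_nonneg.mpr hb')
      linarith
  have k0 := key (p 0) (q 0) (by linarith) (by linarith) q1 q2
  have k1 := key (p 1) (q 1) (by linarith) (by linarith) q3 q4
  refine ⟨⟨⟨?_, ?_⟩, ?_, ?_⟩, ?_⟩
  · simpa using k0.1.le
  · simpa using k0.2.le
  · simpa using k1.1.le
  · simpa using k1.2.le
  · rintro (h | h)
    · have := congrArg (fun q : Plane => q 0) h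
      simp at this
      linarith
    · have := congrArg (fun q : Plane => q 0) h
      simp at this
      linarith

theorem mapsTo_smoothMap {δ c : ℝ} (hδ : 0 < δ) (hδ' : δ ≤ 1 / 1000) (hc : 0 < c)
    (hcδ : 2 * c ≤ δ) : MapsTo (smoothMap δ c) phaseSpace phaseSpace := by
  intro p hp
  rcases lt_or_ge ‖p - pStar‖ (6 * δ * Real.sqrt 2) with h | h
  · have hR := norm_snapMap_sub_le hδ hc p
    have h9 := six_mul_sqrt_two_lt hδ
    have hs := smoothSigma_mem hδ hc hcδ ‖p - pStar‖
    rcases eq_or_lt_of_le hs.2 with h1 | h1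
    · rw [smoothMap, perturbedMap, h1]
      simpa using minimalMap_mem_phaseSpace hp
    · exact combo_mem_phaseSpace hs.1 h1 (by linarith)
        (minimalMap_mem_unitSquare (phaseSpace_subset hp))
  · rw [smoothMap, perturbedMap, smoothSigma_of_ge hδ hc hcδ h]
    simpa using minimalMap_mem_phaseSpace hp

theorem norm_smoothMap_sub_lt {δ c ε : ℝ} (hδ : 0 < δ) (hc : 0 < c) (hcδ : 2 * c ≤ δ)
    (hε : 0 < ε) (hδε : 400 * δ ≤ ε)
    (hF : ∀ p, ‖p - pStar‖ < 9 * δ → ‖minimalMap p - pStar‖ < ε / 2) (p : Plane) :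
    ‖smoothMap δ c p - minimalMap p‖ < ε := by
  have hs := smoothSigma_mem hδ hc hcδ ‖p - pStar‖
  have e : smoothMap δ c p - minimalMap p = (1 - smoothSigma δ c ‖p - pStar‖) •
      ((snapMap (smoothPsi δ c) p - pStar) - (minimalMap p - pStar)) := by
    rw [smoothMap, perturbedMap]
    module
  rcases lt_or_ge ‖p - pStar‖ (6 * δ * Real.sqrt 2) with h | h
  · have hR := norm_snapMap_sub_le hδ hc p
    have h9 := six_mul_sqrt_two_lt hδ
    rw [e, norm_smul, Real.norm_eq_abs, abs_of_nonneg (by linarith [hs.2])]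
    refine (mul_le_of_le_one_left (norm_nonneg _) (by linarith [hs.1])).trans_lt ?_
    refine (norm_sub_le _ _).trans_lt ?_
    have := hF p (by linarith)
    linarith
  · rw [e, smoothSigma_of_ge hδ hc hcδ h]
    simpa using hε

theorem exists_delta {ε : ℝ} (hε : 0 < ε) : ∃ δ : ℝ, 0 < δ ∧ δ ≤ 1 / 1000 ∧ 400 * δ ≤ ε ∧
    ∀ p, ‖p - pStar‖ < 9 * δ → ‖minimalMap p - pStar‖ < ε / 2 := by
  have hF := (contDiffAt_minimalMap denom_pStar_ne).continuousAt
  obtain ⟨ρ, hρ, h⟩ := Metric.continuousAt_iff.mp hF (ε / 2) (by positivity)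
  refine ⟨min (1 / 1000) (min (ε / 400) (ρ / 9)), by positivity, min_le_left _ _, ?_, ?_⟩
  · have := (min_le_right (1 / 1000) (min (ε / 400) (ρ / 9))).trans (min_le_left _ _)
    linarith
  · intro p hp
    have h1 := (min_le_right (1 / 1000) (min (ε / 400) (ρ / 9))).trans (min_le_right _ _)
    have h2 := h (x := p) (by rw [dist_eq_norm]; linarith)
    rwa [minimalMap_pStar, dist_eq_norm] at h2

theorem axis_mem_phaseSpace {t : ℝ} (ht : |t| ≤ 1 / 4) : ofST 0 t ∈ phaseSpace :=
  closedBall_subset_phaseSpace le_rfl (by rwa [mem_closedBall_iff_norm, norm_axis_sub])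

/-! ### Periodic points of all large periods -/

theorem exists_minimalPeriod_eq {δ c : ℝ} (hδ : 0 < δ) (hδ' : δ ≤ 1 / 1000) (hc : 0 < c)
    (hcδ : 2 * c ≤ δ) {n : ℕ} (hn : 2 ≤ n) (hnc : 4 * δ * (1 / 2) ^ n ≤ c) :
    ∃ x ∈ phaseSpace, minimalPeriod (smoothMap δ c) x = n := by
  set z : ℝ := (-2) ^ n with hz
  have hz0 : z ≠ 0 := by positivity
  have hzabs : |1 / z| = (1 / 2) ^ n := by
    rw [hz, abs_div, abs_pow, abs_one, abs_neg, one_div, one_div, inv_pow, abs_two]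
  have hz4 : |1 / z| ≤ 1 / 4 := by
    rw [hzabs]
    exact (pow_le_pow_of_le_one (by norm_num) (by norm_num) hn).trans (by norm_num)
  have hz4' := abs_le.mp hz4
  have h1z : 0 < 1 + 1 / z := by linarith
  -- The orbit is `x ↦ -2x ↦ 4(δ - x)`, then multiplication by `-2` for the other `n - 2` steps.
  -- Returning to `x` means `z * (δ - x) = x`.
  set x : ℝ := δ / (1 + 1 / z) with hx
  have hxe : x + 1 / z * x = δ := by
    rw [← one_add_mul, hx, mul_div_cancel₀ _ h1z.ne']
  have hx0 : 0 < x := div_pos hδ h1z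
  have hx2 : x ≤ 2 * δ := by
    rw [hx, div_le_iff₀ h1z]
    nlinarith
  have hxd : |x - δ| ≤ c / 2 := by
    rw [show x - δ = -(1 / z * x) by linarith, abs_neg, abs_mul, hzabs, abs_of_pos hx0]
    have : (1 / 2 : ℝ) ^ n * x ≤ (1 / 2) ^ n * (2 * δ) :=
      mul_le_mul_of_nonneg_left hx2 (by positivity)
    linarith
  have hxd' := abs_le.mp hxd
  let y : ℕ → ℝ := fun k => if k = 0 then x else if k = 1 then -(2 * x) else (-2) ^ k / z * x
  have hpow (k : ℕ) (hk : k < n) : |(-2 : ℝ) ^ k / z| ≤ 1 / 2 := by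
    obtain ⟨m, rfl⟩ : ∃ m, n = k + m + 1 := ⟨n - k - 1, by omega⟩
    rw [hz, abs_div, abs_pow, abs_pow, abs_neg, abs_two, pow_succ, pow_add,
      div_le_iff₀ (by positivity)]
    have : (1 : ℝ) ≤ 2 ^ m := one_le_pow₀ (by norm_num)
    have : (0 : ℝ) < 2 ^ k := by positivity
    nlinarith
  have hy : ∀ k < n, |y k| ≤ 5 * δ ∧ smoothPsi δ c (y k) = y (k + 1) := by
    intro k hk
    match k with
    | 0 =>
      simp only [y, if_true, zero_add, one_ne_zero, if_false]
      rw [abs_of_pos hx0, smoothPsi_inner hδ hc (by rw [abs_of_pos hx0]; linarith)]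
      exact ⟨by linarith, by ring⟩
    | 1 =>
      simp only [y, if_true, one_ne_zero, if_false, Nat.reduceAdd, OfNat.ofNat_ne_zero,
        OfNat.ofNat_ne_one]
      rw [abs_neg, abs_of_pos (by linarith),
        smoothPsi_middle_neg hδ hc (by linarith) (by linarith)]
      exact ⟨by linarith, by linear_combination (-4) * hxe⟩
    | k + 2 =>
      have h1 : |(-2 : ℝ) ^ (k + 2) / z * x| ≤ δ := by
        rw [abs_mul, abs_of_pos hx0]
        have := mul_le_mul_of_nonneg_right (hpow _ hk) hx0.le
        linarith
      have e (j : ℕ) : y (j + 2) = (-2) ^ (j + 2) / z * x := by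
        simp [y]
      rw [show k + 2 + 1 = (k + 1) + 2 by ring, e, e,
        smoothPsi_inner hδ hc (by linarith)]
      exact ⟨by linarith, by ring⟩
  have hiter (k : ℕ) (hk : k ≤ n) : (smoothMap δ c)^[k] (ofST 0 x) = ofST 0 (y k) :=
    smoothMap_iterate_axis hδ hc hcδ fun j hj => hy j (by omega)
  have hper : IsPeriodicPt (smoothMap δ c) n (ofST 0 x) := by
    have : y n = x := by
      simp only [y]
      rw [if_neg (by omega), if_neg (by omega), ← hz, div_self hz0, one_mul]
    rw [IsPeriodicPt, IsFixedPt, hiter n le_rfl, this]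
  refine ⟨ofST 0 x, axis_mem_phaseSpace (by rw [abs_of_pos hx0]; linarith), ?_⟩
  refine le_antisymm (hper.minimalPeriod_le (by omega)) (not_lt.mp fun hlt => ?_)
  have hpos := hper.minimalPeriod_pos (by omega)
  have h := isPeriodicPt_minimalPeriod (smoothMap δ c) (ofST 0 x)
  rw [IsPeriodicPt, IsFixedPt, hiter _ hlt.le, ofST_inj] at h
  simp only [y] at h
  rw [if_neg hpos.ne'] at h
  -- Time `1` gives `-2x ≠ x`; at times from `2` to `n - 1` the orbit is at most `x / 2` in modulus.
  split_ifs at h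
  · linarith
  · have h1 := abs_le.mp (hpow _ hlt)
    nlinarith

/-! ### The scrambled set -/

/-- The point of the stable manifold with signed itinerary `(e, sparseSeq α)` shifted by `i`. -/
noncomputable def codePoint (δ e : ℝ) (i : ℕ) (α : ℝ) : Plane :=
  ofST 0 (δ * (e * tentPoint fun n => sparseSeq α (n + i)))

theorem smoothPsi_tentPoint {δ c e : ℝ} (hδ : 0 < δ) (hc : 0 < c) (hcδ : 8 * c ≤ δ)
    (he : e = 1 ∨ e = -1) {d : ℕ → ℝ} (hd : IsGoldenMean d) :
    smoothPsi δ c (δ * (e * tentPoint d)) = δ * (-e * tentPoint fun n => d (n + 1)) := by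
  have key : smoothPsi δ c (δ * tentPoint d) = -(δ * tentPoint fun n => d (n + 1)) := by
    have h0 := hd.half_le
    rcases hd.1 0 with h | h
    · have h1 := hd.le_of_zero h
      rw [smoothPsi_inner hδ hc (by rw [abs_of_pos (by positivity)]; nlinarith),
        hd.1.tentPoint_of_zero h]
      ring
    · have h1 := hd.le_of_one h
      have h2 := hd.le_seven_fourths
      rw [smoothPsi_middle hδ hc (by nlinarith) (by nlinarith), hd.1.tentPoint_of_one h]
      ring
  rcases he with rfl | rfl
  · rw [one_mul, key]
    ring
  · rw [neg_one_mul, mul_neg, smoothPsi_neg, key]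
    ring

theorem smoothMap_codePoint {δ c e α : ℝ} (hδ : 0 < δ) (hc : 0 < c) (hcδ : 8 * c ≤ δ)
    (he : e = 1 ∨ e = -1) (hα : 1 ≤ α) (hα' : α < 2) (i : ℕ) :
    smoothMap δ c (codePoint δ e i α) = codePoint δ (-e) (i + 1) α := by
  have hd := (isGoldenMean_sparseSeq hα hα').shift i
  have h1 := hd.half_le
  have h2 := hd.le_seven_fourths
  rw [codePoint, smoothMap_axis hδ hc (by linarith), smoothPsi_tentPoint hδ hc hcδ he hd,
    codePoint]
  · simp only [add_assoc, add_comm 1 i]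
  · rw [abs_mul, abs_mul, abs_of_pos hδ, abs_of_pos (by linarith : 0 < tentPoint _),
      show |e| = 1 by rcases he with rfl | rfl <;> simp]
    nlinarith

theorem sign_mul_neg_one_pow {e : ℝ} (he : e = 1 ∨ e = -1) (k : ℕ) :
    e * (-1) ^ k = 1 ∨ e * (-1) ^ k = -1 := by
  rcases he with rfl | rfl <;> rcases neg_one_pow_eq_or ℝ k with h | h <;> simp [h]

theorem smoothMap_iterate_codePoint {δ c e α : ℝ} (hδ : 0 < δ) (hc : 0 < c) (hcδ : 8 * c ≤ δ)
    (he : e = 1 ∨ e = -1) (hα : 1 ≤ α) (hα' : α < 2) (i k : ℕ) :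
    (smoothMap δ c)^[k] (codePoint δ e i α) = codePoint δ (e * (-1) ^ k) (i + k) α := by
  induction k with
  | zero => simp
  | succ k ih =>
    rw [iterate_succ_apply', ih,
      smoothMap_codePoint hδ hc hcδ (sign_mul_neg_one_pow he k) hα hα', pow_succ]
    congr 1
    ring

theorem codePoint_mem_phaseSpace {δ e α : ℝ} (hδ : 0 < δ) (hδ' : δ ≤ 1 / 1000)
    (he : e = 1 ∨ e = -1) (i : ℕ) : codePoint δ e i α ∈ phaseSpace := by
  have h := ((isBinary_sparseSeq α).shift i).tentPoint_mem
  refine axis_mem_phaseSpace ?_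
  rw [abs_mul, abs_mul, abs_of_pos hδ, abs_of_nonneg h.1,
    show |e| = 1 by rcases he with rfl | rfl <;> simp]
  nlinarith [h.2]

/-- Code points with different signs or different first digits are far apart. -/
theorem le_edist_codePoint {δ e e' α α' : ℝ} (hδ : 0 < δ) (he : e = 1 ∨ e = -1)
    (he' : e' = 1 ∨ e' = -1) (hα : α ∈ Ico (1 : ℝ) 2) (hα' : α' ∈ Ico (1 : ℝ) 2) {i i' : ℕ}
    (h : e ≠ e' ∨ sparseSeq α i ≠ sparseSeq α' i') :
    ENNReal.ofReal (δ / 4) ≤ edist (codePoint δ e i α) (codePoint δ e' i' α') := by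
  have hd := (isGoldenMean_sparseSeq hα.1 hα.2).shift i
  have hd' := (isGoldenMean_sparseSeq hα'.1 hα'.2).shift i'
  rw [codePoint, codePoint, edist_axis, ← mul_sub, abs_mul, abs_of_pos hδ]
  refine ENNReal.ofReal_le_ofReal ?_
  rw [div_eq_mul_one_div]
  refine mul_le_mul_of_nonneg_left ?_ hδ.le
  have a := hd.half_le
  have a' := hd'.half_le
  rw [le_abs]
  rcases eq_or_ne e e' with rfl | hne
  · have hs := h.resolve_left (by simp)
    have key : 1 / 4 ≤ (tentPoint fun n => sparseSeq α (n + i)) -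
          (tentPoint fun n => sparseSeq α' (n + i')) ∨
        1 / 4 ≤ (tentPoint fun n => sparseSeq α' (n + i')) -
          (tentPoint fun n => sparseSeq α (n + i)) := by
      rcases hd.1 0 with b | b <;> rcases hd'.1 0 with b' | b'
      · simp only [zero_add] at b b'
        exact absurd (b.trans b'.symm) hs
      · right
        linarith [hd.le_of_zero b, hd'.le_of_one b']
      · left
        linarith [hd.le_of_one b, hd'.le_of_zero b']
      · simp only [zero_add] at b b'
        exact absurd (b.trans b'.symm) hs
    rcases he with rfl | rfl
    · rcases key with k | k
      · left
        linarith
      · right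
        linarith
    · rcases key with k | k
      · right
        linarith
      · left
        linarith
  · rcases he with rfl | rfl <;> rcases he' with rfl | rfl
    · exact absurd rfl hne
    · left
      linarith
    · right
      linarith
    · exact absurd rfl hne

/-- The scrambled set: all signed shifts of the sparse sequences. -/
def scrambledSet (δ : ℝ) : Set Plane :=
  {x | ∃ e i α, (e = 1 ∨ e = -1) ∧ α ∈ Ico (1 : ℝ) 2 ∧ x = codePoint δ e i α}

theorem limsup_pos_of_ne {δ c : ℝ} (hδ : 0 < δ) (hc : 0 < c) (hcδ : 8 * c ≤ δ) {x y : Plane}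
    (hx : x ∈ scrambledSet δ) (hy : y ∈ scrambledSet δ) (hxy : x ≠ y) :
    0 < limsup (fun k : ℕ => edist ((smoothMap δ c)^[k] x) ((smoothMap δ c)^[k] y)) atTop := by
  obtain ⟨e, i, α, he, hα, rfl⟩ := hx
  obtain ⟨e', i', α', he', hα', rfl⟩ := hy
  have hpos : 0 < ENNReal.ofReal (δ / 4) := ENNReal.ofReal_pos.mpr (by positivity)
  refine hpos.trans_le (le_limsup_of_frequently_le' ?_)
  -- Both signs flip at every step, so signs that differ once differ forever; otherwise the
  -- itineraries must disagree infinitely often.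
  have hfreq : ∃ᶠ k in atTop, e ≠ e' ∨ sparseSeq α (k + i) ≠ sparseSeq α' (k + i') := by
    by_contra hcon
    rw [not_frequently] at hcon
    obtain ⟨k, hk⟩ := hcon.exists
    have hee : e = e' := by
      by_contra hne
      exact hk (Or.inl hne)
    obtain ⟨rfl, rfl⟩ := eq_of_eventually_sparseSeq_eq hα.1 hα.2 hα'.1 hα'.2
      (hcon.mono fun k hk => not_not.mp (not_or.mp hk).2)
    rw [hee] at hxy
    exact hxy rfl
  refine hfreq.mono fun k hk => ?_
  rw [smoothMap_iterate_codePoint hδ hc hcδ he hα.1 hα.2,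
    smoothMap_iterate_codePoint hδ hc hcδ he' hα'.1 hα'.2]
  refine le_edist_codePoint hδ (sign_mul_neg_one_pow he k) (sign_mul_neg_one_pow he' k) hα hα' ?_
  rw [add_comm i, add_comm i']
  exact hk.imp_left fun h h' => h (mul_right_cancel₀ (pow_ne_zero k (by norm_num)) h')

theorem limsup_pos_of_periodic {δ c : ℝ} (hδ : 0 < δ) (hc : 0 < c) (hcδ : 8 * c ≤ δ)
    {x y : Plane} (hx : x ∈ scrambledSet δ) (hy : y ∈ periodicPts (smoothMap δ c)) :
    0 < limsup (fun k : ℕ => edist ((smoothMap δ c)^[k] x) ((smoothMap δ c)^[k] y)) atTop := by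
  obtain ⟨e, i, α, he, hα, rfl⟩ := hx
  obtain ⟨p, hp, hy⟩ := hy
  refine (zero_le).lt_of_ne' fun h0 => ?_
  have hev := eventually_lt_of_limsup_lt
    (h0.trans_lt (ENNReal.ofReal_pos.mpr (by positivity : 0 < δ / 8)))
  have hev' := (tendsto_add_atTop_nat p).eventually hev
  -- An orbit asymptotic to one of period `p` is asymptotic to its own shift by `p`, so its digits
  -- would be eventually `p`-periodic.
  have hper : ∀ᶠ k in atTop, sparseSeq α (k + i) = sparseSeq α (k + (i + p)) := by
    filter_upwards [hev, hev'] with k h1 h2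
    by_contra hne
    rw [iterate_add_apply _ k p y, hy.eq, edist_comm] at h2
    have h3 := (edist_triangle _ _ _).trans_lt (ENNReal.add_lt_add h1 h2)
    rw [← ENNReal.ofReal_add (by positivity) (by positivity),
      smoothMap_iterate_codePoint hδ hc hcδ he hα.1 hα.2,
      smoothMap_iterate_codePoint hδ hc hcδ he hα.1 hα.2] at h3
    have h4 := le_edist_codePoint (i := i + k) (i' := i + (k + p)) hδ
      (sign_mul_neg_one_pow he k) (sign_mul_neg_one_pow he (k + p)) hα hα (Or.inr (by
        rwa [add_comm i k, show i + (k + p) = k + (i + p) by ring]))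
    rw [show δ / 8 + δ / 8 = δ / 4 by ring] at h3
    exact absurd (h4.trans_lt h3) (lt_irrefl _)
  have := (eq_of_eventually_sparseSeq_eq hα.1 hα.2 hα.1 hα.2 hper).2
  omega

theorem liminf_codePoint_eq_zero {δ c α β : ℝ} (hδ : 0 < δ) (hc : 0 < c) (hcδ : 8 * c ≤ δ)
    (hα : α ∈ Ico (1 : ℝ) 2) (hβ : β ∈ Ico (1 : ℝ) 2) :
    liminf (fun k : ℕ => edist ((smoothMap δ c)^[k] (codePoint δ 1 0 α))
      ((smoothMap δ c)^[k] (codePoint δ 1 0 β))) atTop = 0 := by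
  -- At time `2 * 4 ^ m` both itineraries begin a block of ones reaching to `4 ^ (m + 1)`, which is
  -- longer than `m`.
  have hbound (m : ℕ) : edist ((smoothMap δ c)^[2 * 4 ^ m] (codePoint δ 1 0 α))
      ((smoothMap δ c)^[2 * 4 ^ m] (codePoint δ 1 0 β)) ≤
        ENNReal.ofReal (δ * (2 * (1 / 2) ^ m)) := by
    rw [smoothMap_iterate_codePoint hδ hc hcδ (Or.inl rfl) hα.1 hα.2,
      smoothMap_iterate_codePoint hδ hc hcδ (Or.inl rfl) hβ.1 hβ.2, codePoint, codePoint,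
      edist_axis]
    refine ENNReal.ofReal_le_ofReal ?_
    rw [← mul_sub, ← mul_sub, abs_mul, abs_mul, abs_of_pos hδ, abs_mul, abs_one, abs_pow,
      abs_neg, abs_one, one_pow, one_mul, one_mul]
    refine mul_le_mul_of_nonneg_left ?_ hδ.le
    refine abs_tentPoint_sub_le m ((isBinary_sparseSeq α).shift _)
      ((isBinary_sparseSeq β).shift _) fun k hk => ?_
    have hm : m < 4 ^ m := Nat.lt_pow_self (by norm_num)
    have h4 : 4 ^ (m + 1) = 4 * 4 ^ m := by ring
    rw [sparseSeq_of_between (m := m) hα.1 hα.2 (by omega) (by omega),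
      sparseSeq_of_between (m := m) hβ.1 hβ.2 (by omega) (by omega)]
  refine le_antisymm (le_of_forall_pos_le_add fun r hr => ?_) zero_le
  rw [zero_add]
  have hlim : Tendsto (fun m : ℕ => ENNReal.ofReal (δ * (2 * (1 / 2) ^ m))) atTop (nhds 0) := by
    have h := ((tendsto_pow_atTop_nhds_zero_of_lt_one (r := (1 / 2 : ℝ)) (by norm_num)
      (by norm_num)).const_mul 2).const_mul δ
    simpa using ENNReal.tendsto_ofReal h
  have hto : Tendsto (fun m : ℕ => 2 * 4 ^ m) atTop atTop :=
    (tendsto_pow_atTop_atTop_of_one_lt (by norm_num)).const_mul_atTop' two_pos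
  refine liminf_le_of_frequently_le' (hto.frequently (Eventually.frequently ?_))
  filter_upwards [hlim.eventually_lt_const hr] with m hm
  exact (hbound m).trans hm.le

theorem codePoint_injOn {δ c : ℝ} (hδ : 0 < δ) (hc : 0 < c) (hcδ : 8 * c ≤ δ) :
    InjOn (codePoint δ 1 0) (Ico (1 : ℝ) 2) := by
  intro α hα β hβ h
  refine (eq_of_eventually_sparseSeq_eq (i := 0) (j := 0) hα.1 hα.2 hβ.1 hβ.2
    (Eventually.of_forall fun k => ?_)).1
  by_contra hne
  have h1 := le_edist_codePoint (i := k) (i' := k) hδ (sign_mul_neg_one_pow (Or.inl rfl) k)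
    (sign_mul_neg_one_pow (Or.inl rfl) k) hα hβ (Or.inr hne)
  have e := congrArg (smoothMap δ c)^[k] h
  rw [smoothMap_iterate_codePoint hδ hc hcδ (Or.inl rfl) hα.1 hα.2,
    smoothMap_iterate_codePoint hδ hc hcδ (Or.inl rfl) hβ.1 hβ.2, zero_add] at e
  rw [e, edist_self, nonpos_iff_eq_zero, ENNReal.ofReal_eq_zero] at h1
  linarith

theorem not_countable_Ico_one_two : ¬ (Ico (1 : ℝ) 2).Countable := by
  rw [← Cardinal.le_aleph0_iff_set_countable, Cardinal.mk_Ico_real (by norm_num), not_le]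
  exact Cardinal.aleph0_lt_continuum

theorem isMarottoChaotic_smoothMap {δ c : ℝ} (hδ : 0 < δ) (hδ' : δ ≤ 1 / 1000) (hc : 0 < c)
    (hcδ : 8 * c ≤ δ) : IsMarottoChaotic (smoothMap δ c) phaseSpace := by
  have hS₀ : ¬ (codePoint δ 1 0 '' Ico (1 : ℝ) 2).Countable := fun h =>
    not_countable_Ico_one_two
      (countable_of_injective_of_countable_image (codePoint_injOn hδ hc hcδ) h)
  have hsub : codePoint δ 1 0 '' Ico (1 : ℝ) 2 ⊆ scrambledSet δ := by
    rintro _ ⟨α, hα, rfl⟩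
    exact ⟨1, 0, α, Or.inl rfl, hα, rfl⟩
  refine ⟨?_, scrambledSet δ, ?_, fun h => hS₀ (h.mono hsub), ?_, ?_,
    fun x hx y hy hxy => limsup_pos_of_ne hδ hc hcδ hx hy hxy,
    fun x hx y _ hy => limsup_pos_of_periodic hδ hc hcδ hx hy,
    _, hsub, hS₀, ?_⟩
  · obtain ⟨m, hm⟩ := exists_pow_lt_of_lt_one (show 0 < c / (4 * δ) by positivity)
      (show (1 / 2 : ℝ) < 1 by norm_num)
    refine ⟨m + 2, by omega, fun n hn =>
      exists_minimalPeriod_eq hδ hδ' hc (by linarith) (by omega) ?_⟩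
    have h1 : (1 / 2 : ℝ) ^ n ≤ (1 / 2) ^ m :=
      pow_le_pow_of_le_one (by norm_num) (by norm_num) (by omega)
    rw [lt_div_iff₀ (by positivity)] at hm
    nlinarith
  · rintro _ ⟨e, i, α, he, -, rfl⟩
    exact codePoint_mem_phaseSpace hδ hδ' he i
  · intro x hx hper
    -- A periodic point would be at positive limsup distance from itself.
    have h := limsup_pos_of_periodic hδ hc hcδ hx hper
    simp at h
  · rintro _ ⟨e, i, α, he, hα, rfl⟩
    exact ⟨-e, i + 1, α, by rcases he with rfl | rfl <;> simp, hα,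
      smoothMap_codePoint hδ hc hcδ he hα.1 hα.2 i⟩
  · rintro _ ⟨α, hα, rfl⟩ _ ⟨β, hβ, rfl⟩
    exact liminf_codePoint_eq_zero hδ hc hcδ hα hβ

end RSFlipFlop

/-! ### Choice of the constants and assembly -/

open RSFlipFlop in
theorem theorem5p3 (ε : ℝ) (hε : 0 < ε) :
    ∃ δ : ℝ, 0 < δ ∧ δ ≤ 0.04 ∧ ∀ η : ℝ, 0 < η →
      ∃ ψ σ : ℝ → ℝ,
        IsCornerSmoothing η {δ, -δ, 3 * δ, -(3 * δ)} (psi δ) ψ ∧ (∀ t, ψ (-t) = -ψ t) ∧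
        IsCornerSmoothing η {5 * δ * Real.sqrt 2, 6 * δ * Real.sqrt 2} (sigma δ) σ ∧
        (∀ r, σ r ∈ Set.Icc (0 : ℝ) 1) ∧
        ContDiffOn ℝ ∞ (perturbedMap σ ψ) mapDomain ∧
        Set.MapsTo (perturbedMap σ ψ) phaseSpace phaseSpace ∧
        (∀ p ∈ mapDomain, ‖perturbedMap σ ψ p - minimalMap p‖ < ε) ∧
        IsSnapBackRepeller (perturbedMap σ ψ) phaseSpace pStar ∧
        (∀ q ∈ ({ofST 0 (2 * δ), ofST 0 (-(2 * δ)), ofST 0 (5 * δ), ofST 0 (-(5 * δ))} :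
          Set Plane), IsSnapBackPoint (perturbedMap σ ψ) pStar q) ∧
        IsMarottoChaotic (perturbedMap σ ψ) phaseSpace := by
  obtain ⟨δ, hδ, hδ', hδε, hF⟩ := exists_delta hε
  refine ⟨δ, hδ, hδ'.trans (by norm_num), fun η hη => ?_⟩
  obtain ⟨c, hc, hcη, hcη', hcδ⟩ :
      ∃ c : ℝ, 0 < c ∧ 20 * c < η ∧ 20 * c < η * δ ∧ 8 * c ≤ δ := by
    have hηδ : 0 < η * δ := by positivity
    refine ⟨min (η / 40) (min (η * δ / 40) (δ / 8)), by positivity, ?_, ?_, ?_⟩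
    · linarith [min_le_left (η / 40) (min (η * δ / 40) (δ / 8))]
    · linarith [(min_le_right (η / 40) (min (η * δ / 40) (δ / 8))).trans (min_le_left _ _)]
    · linarith [(min_le_right (η / 40) (min (η * δ / 40) (δ / 8))).trans (min_le_right _ _)]
  have hcδ' : 2 * c ≤ δ := by linarith
  exact ⟨smoothPsi δ c, smoothSigma δ c, isCornerSmoothing_smoothPsi hδ hc hcη,
    smoothPsi_neg δ c, isCornerSmoothing_smoothSigma hδ hc hcη hcη',
    smoothSigma_mem hδ hc hcδ', contDiffOn_smoothMap hδ hc hcδ',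
    mapsTo_smoothMap hδ hδ' hc hcδ',
    fun p _ => norm_smoothMap_sub_lt hδ hc hcδ' hε hδε hF p,
    isSnapBackRepeller_smoothMap hδ (by linarith) hc hcδ',
    fun q hq => isSnapBackPoint_of_mem hδ hc hcδ' hq,
    isMarottoChaotic_smoothMap hδ hδ' hc hcδ⟩
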